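/- Let $0<R_1<R_2$, $c_1>0$, $c_2\in\mathbb R$, $\Theta>0$, put $\alpha=c_2/\Theta$, and let $n\in\mathbb Z$. On the complex Hilbert space $L^2(R_1,R_2)^2$ consider the unbounded operator $$\mathcal A_n\begin{pmatrix}u\\ v\end{pmatrix}=\begin{pmatrix}\dfrac{c_1 n}{r}\,u-\sqrt{c_1\Theta}\;r^{-\frac{\alpha+1}{2}}\,\dfrac{\partial}{\partial r}\Big(r^{\frac{\alpha+1}{2}}v\Big)\\[2mm] \sqrt{c_1\Theta}\;r^{\frac{\alpha+1}{2}}\,\dfrac{\partial}{\partial r}\Big(r^{-\frac{\alpha+1}{2}}u\Big)+\dfrac{c_2 n}{r}\,v\end{pmatrix},$$ with domain $D(\mathcal A_n)=\{(u,v)\in H^1(R_1,R_2)^2:\ v(R_1)=v(R_2)=0\}$. Then there are a sequence of real numbers $(\nu_{nm})_{m\in\mathbb N}$ and a complete orthonormal system $(u_{nm},v_{nm})_{m\in\mathbb N}$ of $L^2(R_1,R_2)^2$, consisting of real-valued functions, such that $(u_{nm},v_{nm})\in D(\mathcal A_n)$ and $\mathcal A_n(u_{nm},v_{nm})=\nu_{nm}(u_{nm},v_{nm})$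 for every $m$, the spectrum of $\mathcal A_n$ is exactly the set $\{\nu_{nm}: m\in\mathbb N\}$, and $|\nu_{nm}|\to\infty$ as $m\to\infty$. -/

import Mathlib

open MeasureTheory Set Filter Topology
open scoped ContDiff

namespace SOH

noncomputable section

/-- The complex Hilbert space `L²(a, b)`, with Lebesgue measure on the open interval. -/
abbrev L2 (a b : ℝ) : Type := Lp ℂ 2 (volume.restrict (Ioo a b))

/-- The Hilbert space `L²(a, b)²`, with
`⟪(u, v), (u', v')⟫ = ⟪u, u'⟫ + ⟪v, v'⟫`. -/
abbrev L2Pair (a b : ℝ) : Type := WithLp 2 (L2 a b × L2 a b)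

/-- `g ∈ L²(a, b)` is the weak derivative of `f ∈ L²(a, b)`: one has `∫ φ' f = - ∫ φ g`
for every test function `φ ∈ C_c^∞((a, b))`. -/
def IsWeakDeriv {a b : ℝ} (f g : L2 a b) : Prop :=
  ∀ φ : ℝ → ℝ, ContDiff ℝ ∞ φ → HasCompactSupport φ → tsupport φ ⊆ Ioo a b →
    ∫ r in Ioo a b, ((deriv φ r : ℝ) : ℂ) * f r = - ∫ r in Ioo a b, ((φ r : ℝ) : ℂ) * g r

lemma memLp_mul {a b : ℝ} {m : ℝ → ℝ} (hm : ContinuousOn m (Icc a b)) (f : L2 a b) :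
    MemLp (fun r => ((m r : ℝ) : ℂ) * f r) 2 (volume.restrict (Ioo a b)) := by
  obtain ⟨C, hC⟩ := isCompact_Icc.exists_bound_of_continuousOn hm
  have hmeas : AEStronglyMeasurable (fun r => ((m r : ℝ) : ℂ)) (volume.restrict (Ioo a b)) :=
    (Complex.continuous_ofReal.comp_continuousOn
      (hm.mono Ioo_subset_Icc_self)).aestronglyMeasurable measurableSet_Ioo
  refine MemLp.of_le_mul (c := C) (Lp.memLp f) (hmeas.mul (Lp.aestronglyMeasurable f)) ?_
  filter_upwards [ae_restrict_mem measurableSet_Ioo] with r hr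
  rw [norm_mul, Complex.norm_real]
  exact mul_le_mul_of_nonneg_right (hC r (Ioo_subset_Icc_self hr)) (norm_nonneg _)

/-- Multiplication by a function `m`, continuous on `[a, b]`, as an operator of `L²(a, b)`. -/
def mulL2 {a b : ℝ} (m : ℝ → ℝ) (hm : ContinuousOn m (Icc a b)) : L2 a b →ₗ[ℂ] L2 a b where
  toFun f := (memLp_mul hm f).toLp _
  map_add' f g := by
    rw [← MemLp.toLp_add]
    apply MemLp.toLp_congr
    filter_upwards [Lp.coeFn_add f g] with r hr
    rw [hr]; simp [mul_add]
  map_smul' c f := by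
    rw [RingHom.id_apply, ← MemLp.toLp_const_smul]
    apply MemLp.toLp_congr
    filter_upwards [Lp.coeFn_smul c f] with r hr
    rw [hr]; simp only [Pi.smul_apply, smul_eq_mul]; ring

lemma mulL2_ae {a b : ℝ} (m : ℝ → ℝ) (hm : ContinuousOn m (Icc a b)) (f : L2 a b) :
    ∀ᵐ r ∂(volume.restrict (Ioo a b)), mulL2 m hm f r = ((m r : ℝ) : ℂ) * f r :=
  (memLp_mul hm f).coeFn_toLp

lemma integrable_test {a b : ℝ} {φ : ℝ → ℝ} (hφ : ContinuousOn φ (Icc a b)) (f : L2 a b) :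
    Integrable (fun r => ((φ r : ℝ) : ℂ) * f r) (volume.restrict (Ioo a b)) :=
  (memLp_mul hφ f).integrable (by norm_num)

lemma IsWeakDeriv.add {a b : ℝ} {f g f' g' : L2 a b} (h : IsWeakDeriv f g)
    (h' : IsWeakDeriv f' g') : IsWeakDeriv (f + f') (g + g') := by
  intro φ hφ hc hs
  have hd : Continuous (deriv φ) := hφ.continuous_deriv (by simp)
  have e1 : ∫ r in Ioo a b, ((deriv φ r : ℝ) : ℂ) * (f + f' : L2 a b) r
      = ∫ r in Ioo a b, (((deriv φ r : ℝ) : ℂ) * f r + ((deriv φ r : ℝ) : ℂ) * f' r) := by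
    apply integral_congr_ae
    filter_upwards [Lp.coeFn_add f f'] with r hr
    rw [hr]; simp [mul_add]
  have e2 : ∫ r in Ioo a b, ((φ r : ℝ) : ℂ) * (g + g' : L2 a b) r
      = ∫ r in Ioo a b, (((φ r : ℝ) : ℂ) * g r + ((φ r : ℝ) : ℂ) * g' r) := by
    apply integral_congr_ae
    filter_upwards [Lp.coeFn_add g g'] with r hr
    rw [hr]; simp [mul_add]
  rw [e1, e2, integral_add (integrable_test hd.continuousOn f) (integrable_test hd.continuousOn f'),
    integral_add (integrable_test hφ.continuous.continuousOn g)
      (integrable_test hφ.continuous.continuousOn g'), h φ hφ hc hs, h' φ hφ hc hs]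
  ring

lemma IsWeakDeriv.smul {a b : ℝ} {f g : L2 a b} (c : ℂ) (h : IsWeakDeriv f g) :
    IsWeakDeriv (c • f) (c • g) := by
  intro φ hφ hc hs
  have e1 : ∫ r in Ioo a b, ((deriv φ r : ℝ) : ℂ) * (c • f : L2 a b) r
      = ∫ r in Ioo a b, c * (((deriv φ r : ℝ) : ℂ) * f r) := by
    apply integral_congr_ae
    filter_upwards [Lp.coeFn_smul c f] with r hr
    rw [hr]; simp only [Pi.smul_apply, smul_eq_mul]; ring
  have e2 : ∫ r in Ioo a b, ((φ r : ℝ) : ℂ) * (c • g : L2 a b) r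
      = ∫ r in Ioo a b, c * (((φ r : ℝ) : ℂ) * g r) := by
    apply integral_congr_ae
    filter_upwards [Lp.coeFn_smul c g] with r hr
    rw [hr]; simp only [Pi.smul_apply, smul_eq_mul]; ring
  rw [e1, e2, integral_const_mul, integral_const_mul, h φ hφ hc hs]
  ring

lemma IsWeakDeriv.unique {a b : ℝ} {f g g' : L2 a b} (h : IsWeakDeriv f g)
    (h' : IsWeakDeriv f g') : g = g' := by
  have h0 := h.add (h'.smul (-1))
  rw [← sub_eq_zero]
  have hz : IsWeakDeriv (0 : L2 a b) (g - g') := by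
    convert h0 using 1
    · simp
    · simp [sub_eq_add_neg]
  have key : ∀ᵐ r ∂volume, r ∈ Ioo a b → (g - g' : L2 a b) r = 0 := by
    refine isOpen_Ioo.ae_eq_zero_of_integral_contDiff_smul_eq_zero ?_ ?_
    · have hi : IntegrableOn (fun r => (g - g' : L2 a b) r) (Ioo a b) :=
        (Lp.memLp (g - g')).integrable (by norm_num)
      exact hi.locallyIntegrableOn
    · intro φ hφ hc hs
      have := hz φ hφ hc hs
      have e1 : ∫ r in Ioo a b, ((deriv φ r : ℝ) : ℂ) * (0 : L2 a b) r = 0 := by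
        rw [← integral_zero ℝ ℂ (μ := volume.restrict (Ioo a b))]
        apply integral_congr_ae
        filter_upwards [Lp.coeFn_zero ℂ 2 (volume.restrict (Ioo a b))] with r hr
        rw [hr]; simp
      rw [e1, eq_comm, neg_eq_zero] at this
      rw [← this, ← setIntegral_eq_integral_of_forall_compl_eq_zero (s := Ioo a b)]
      · simp only [Complex.real_smul]
      · intro x hx
        have : φ x = 0 := image_eq_zero_of_notMem_tsupport (fun hx' => hx (hs hx'))
        simp [this]
  rw [Lp.eq_zero_iff_ae_eq_zero]
  exact (ae_restrict_iff' measurableSet_Ioo).2 key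

/-- The Sobolev space `H¹(a, b)`: the functions of `L²(a, b)` that have a weak derivative in
`L²(a, b)`. -/
def H1 (a b : ℝ) : Submodule ℂ (L2 a b) where
  carrier := {f | ∃ g, IsWeakDeriv f g}
  add_mem' := by
    rintro f f' ⟨g, h⟩ ⟨g', h'⟩
    exact ⟨_, h.add h'⟩
  zero_mem' := by
    refine ⟨0, ?_⟩
    intro φ _ _ _
    have h0 := Lp.coeFn_zero ℂ 2 (volume.restrict (Ioo a b))
    have e : ∀ ψ : ℝ → ℝ, ∫ r in Ioo a b, ((ψ r : ℝ) : ℂ) * (0 : L2 a b) r = 0 := by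
      intro ψ
      rw [← integral_zero ℝ ℂ (μ := volume.restrict (Ioo a b))]
      apply integral_congr_ae
      filter_upwards [h0] with r hr
      rw [hr]; simp
    rw [e, e, neg_zero]
  smul_mem' := by
    rintro c f ⟨g, h⟩
    exact ⟨_, h.smul c⟩

/-- The weak derivative `∂/∂r : H¹(a, b) → L²(a, b)`. -/
def weakDeriv (a b : ℝ) : H1 a b →ₗ[ℂ] L2 a b where
  toFun f := f.2.choose
  map_add' f g := (f + g).2.choose_spec.unique (f.2.choose_spec.add g.2.choose_spec)
  map_smul' c f := (c • f).2.choose_spec.unique (f.2.choose_spec.smul c)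

lemma weakDeriv_spec {a b : ℝ} (f : H1 a b) : IsWeakDeriv (f : L2 a b) (weakDeriv a b f) :=
  f.2.choose_spec

/-- Multiplication by a function that is smooth on `(0, ∞)` preserves `H¹(a, b)`, `0 < a`. -/
lemma mulL2_mem_H1 {a b : ℝ} (ha : 0 < a) {m : ℝ → ℝ} (hm : ContinuousOn m (Icc a b))
    (hs : ContDiffOn ℝ ∞ m (Ioi 0)) {f : L2 a b} (hf : f ∈ H1 a b) :
    mulL2 m hm f ∈ H1 a b := by
  obtain ⟨g, hg⟩ := hf
  have hsub : Icc a b ⊆ Ioi (0 : ℝ) := fun r hr => lt_of_lt_of_le ha hr.1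
  have hm' : ContinuousOn (deriv m) (Icc a b) :=
    (hs.continuousOn_deriv_of_isOpen isOpen_Ioi (by simp)).mono hsub
  refine ⟨mulL2 m hm g + mulL2 (deriv m) hm' f, ?_⟩
  intro φ hφ hc ht
  have hφ' : Continuous (deriv φ) := hφ.continuous_deriv (by simp)
  have hat : ∀ x ∈ Ioo a b, ContDiffAt ℝ ∞ m x := fun x hx =>
    hs.contDiffAt (isOpen_Ioi.mem_nhds (hsub (Ioo_subset_Icc_self hx)))
  have hts : tsupport (fun r => φ r * m r) ⊆ tsupport φ := tsupport_mul_subset_left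
  have htest := hg (fun r => φ r * m r)
    (contDiff_iff_contDiffAt.2 fun x => by
      by_cases hx : x ∈ tsupport φ
      · exact hφ.contDiffAt.mul (hat x (ht hx))
      · refine (contDiffAt_const (c := (0 : ℝ))).congr_of_eventuallyEq ?_
        filter_upwards [notMem_tsupport_iff_eventuallyEq.1 hx] with y hy
        simp [hy])
    hc.mul_right (hts.trans ht)
  have e0 : ∫ r in Ioo a b, ((deriv (fun r => φ r * m r) r : ℝ) : ℂ) * f r
      = ∫ r in Ioo a b, (((deriv φ r : ℝ) : ℂ) * mulL2 m hm f r
          + ((φ r : ℝ) : ℂ) * mulL2 (deriv m) hm' f r) := by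
    apply integral_congr_ae
    filter_upwards [ae_restrict_mem measurableSet_Ioo, mulL2_ae m hm f,
      mulL2_ae (deriv m) hm' f] with r hr h1 h2
    rw [h1, h2, deriv_fun_mul (hφ.differentiable (by simp) r)
      ((hat r hr).differentiableAt (by simp))]
    push_cast; ring
  have e1 : ∫ r in Ioo a b, ((φ r * m r : ℝ) : ℂ) * g r
      = ∫ r in Ioo a b, ((φ r : ℝ) : ℂ) * mulL2 m hm g r := by
    apply integral_congr_ae
    filter_upwards [mulL2_ae m hm g] with r h1
    rw [h1]; push_cast; ring
  have e2 : ∫ r in Ioo a b, ((φ r : ℝ) : ℂ) * (mulL2 m hm g + mulL2 (deriv m) hm' f : L2 a b) r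
      = ∫ r in Ioo a b, (((φ r : ℝ) : ℂ) * mulL2 m hm g r
          + ((φ r : ℝ) : ℂ) * mulL2 (deriv m) hm' f r) := by
    apply integral_congr_ae
    filter_upwards [Lp.coeFn_add (mulL2 m hm g) (mulL2 (deriv m) hm' f)] with r hr
    rw [hr]; simp [mul_add]
  have i1 := integrable_test hφ'.continuousOn (mulL2 m hm f)
  have i2 := integrable_test hφ.continuous.continuousOn (mulL2 (deriv m) hm' f)
  have i3 := integrable_test hφ.continuous.continuousOn (mulL2 m hm g)
  rw [e0, integral_add i1 i2] at htest
  rw [e2, integral_add i3 i2, ← e1, eq_comm, ← sub_eq_zero]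
  linear_combination -htest

/-- `v(a) = v(b) = 0` for (the continuous representative on `[a, b]` of) `v`. -/
def VanishesAtEnds {a b : ℝ} (v : L2 a b) : Prop :=
  ∃ V : ℝ → ℂ, ContinuousOn V (Icc a b) ∧ (∀ᵐ r ∂(volume.restrict (Ioo a b)), v r = V r) ∧
    V a = 0 ∧ V b = 0

/-- `D(𝒜ₙ) = {(u, v) ∈ H¹(a, b)² : v(a) = v(b) = 0}`. -/
def domainA (a b : ℝ) : Submodule ℂ (L2Pair a b) where
  carrier := {x | x.fst ∈ H1 a b ∧ x.snd ∈ H1 a b ∧ VanishesAtEnds x.snd}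
  add_mem' := by
    rintro x y ⟨hx1, hx2, V, hV, hVe, hVa, hVb⟩ ⟨hy1, hy2, W, hW, hWe, hWa, hWb⟩
    refine ⟨(H1 a b).add_mem hx1 hy1, (H1 a b).add_mem hx2 hy2, fun r => V r + W r,
      hV.add hW, ?_, by simp [hVa, hWa], by simp [hVb, hWb]⟩
    filter_upwards [hVe, hWe, Lp.coeFn_add x.snd y.snd] with r h1 h2 h3
    rw [← h1, ← h2]; exact h3
  zero_mem' := by
    refine ⟨(H1 a b).zero_mem, (H1 a b).zero_mem, fun _ => 0, continuousOn_const, ?_, rfl, rfl⟩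
    exact Lp.coeFn_zero ℂ 2 (volume.restrict (Ioo a b))
  smul_mem' := by
    rintro c x ⟨hx1, hx2, V, hV, hVe, hVa, hVb⟩
    refine ⟨(H1 a b).smul_mem c hx1, (H1 a b).smul_mem c hx2, fun r => c * V r,
      continuousOn_const.mul hV, ?_, by simp [hVa], by simp [hVb]⟩
    filter_upwards [hVe, Lp.coeFn_smul c x.snd] with r h1 h2
    rw [← h1]; exact h2

lemma continuousOn_pow {a b : ℝ} (ha : 0 < a) (s : ℝ) :
    ContinuousOn (fun r : ℝ => r ^ s) (Icc a b) := fun r hr =>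
  (Real.continuousAt_rpow_const r s (Or.inl (lt_of_lt_of_le ha hr.1).ne')).continuousWithinAt

lemma continuousOn_inv_pow {a b : ℝ} (ha : 0 < a) (s : ℝ) :
    ContinuousOn (fun r : ℝ => 1 / r ^ s) (Icc a b) :=
  continuousOn_const.div (continuousOn_pow ha s) fun _ hr =>
    (Real.rpow_pos_of_pos (lt_of_lt_of_le ha hr.1) s).ne'

lemma continuousOn_div {a b : ℝ} (ha : 0 < a) (c : ℝ) :
    ContinuousOn (fun r : ℝ => c / r) (Icc a b) :=
  continuousOn_const.div continuousOn_id fun _ hr => (lt_of_lt_of_le ha hr.1).ne'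

lemma contDiffOn_pow (s : ℝ) : ContDiffOn ℝ ∞ (fun r : ℝ => r ^ s) (Ioi 0) := fun _ hr =>
  (Real.contDiffAt_rpow_const_of_ne (ne_of_gt hr)).contDiffWithinAt

lemma contDiffOn_inv_pow (s : ℝ) : ContDiffOn ℝ ∞ (fun r : ℝ => 1 / r ^ s) (Ioi 0) :=
  contDiffOn_const.div (contDiffOn_pow s) fun _ hr => (Real.rpow_pos_of_pos hr s).ne'

/-- `r^s v`, for `v ∈ H¹(a, b)`, as an element of `H¹(a, b)`. -/
def powMulH1 {a b : ℝ} (ha : 0 < a) (s : ℝ) : H1 a b →ₗ[ℂ] H1 a b :=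
  (mulL2 (fun r => r ^ s) (continuousOn_pow ha s)).restrict
    fun _ hf => mulL2_mem_H1 ha _ (contDiffOn_pow s) hf

/-- `u / r^s`, for `u ∈ H¹(a, b)`, as an element of `H¹(a, b)`. -/
def invPowMulH1 {a b : ℝ} (ha : 0 < a) (s : ℝ) : H1 a b →ₗ[ℂ] H1 a b :=
  (mulL2 (fun r => 1 / r ^ s) (continuousOn_inv_pow ha s)).restrict
    fun _ hf => mulL2_mem_H1 ha _ (contDiffOn_inv_pow s) hf

/-- The component `u ∈ H¹(a, b)` of `(u, v) ∈ D(𝒜ₙ)`. -/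
def domFst (a b : ℝ) : domainA a b →ₗ[ℂ] H1 a b where
  toFun x := ⟨(x : L2Pair a b).fst, x.2.1⟩
  map_add' _ _ := rfl
  map_smul' _ _ := rfl

/-- The component `v ∈ H¹(a, b)` of `(u, v) ∈ D(𝒜ₙ)`. -/
def domSnd (a b : ℝ) : domainA a b →ₗ[ℂ] H1 a b where
  toFun x := ⟨(x : L2Pair a b).snd, x.2.2.1⟩
  map_add' _ _ := rfl
  map_smul' _ _ := rfl

/-- With `α = c₂ / Θ` and `s = (α + 1) / 2`, the first component of `𝒜ₙ (u, v)`,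
`(c₁ n / r) u - √(c₁ Θ) r^(-s) ∂/∂r (r^s v)`. Here `Θ` is what `c₂ / α` stands for,
`c₂ = 0` included. -/
def opAFst {R₁ R₂ : ℝ} (hR₁ : 0 < R₁) (c₁ c₂ Θ : ℝ) (n : ℤ) :
    domainA R₁ R₂ →ₗ[ℂ] L2 R₁ R₂ :=
  mulL2 (fun r => c₁ * n / r) (continuousOn_div hR₁ _) ∘ₗ (H1 R₁ R₂).subtype ∘ₗ domFst R₁ R₂
  - ((√(c₁ * Θ) : ℝ) : ℂ) •
    (mulL2 (fun r => 1 / r ^ ((c₂ / Θ + 1) / 2)) (continuousOn_inv_pow hR₁ _) ∘ₗ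
      weakDeriv R₁ R₂ ∘ₗ powMulH1 hR₁ ((c₂ / Θ + 1) / 2) ∘ₗ domSnd R₁ R₂)

/-- With `α = c₂ / Θ` and `s = (α + 1) / 2`, the second component of `𝒜ₙ (u, v)`,
`√(c₁ Θ) r^s ∂/∂r (u / r^s) + (c₂ n / r) v`. -/
def opASnd {R₁ R₂ : ℝ} (hR₁ : 0 < R₁) (c₁ c₂ Θ : ℝ) (n : ℤ) :
    domainA R₁ R₂ →ₗ[ℂ] L2 R₁ R₂ :=
  ((√(c₁ * Θ) : ℝ) : ℂ) •
    (mulL2 (fun r => r ^ ((c₂ / Θ + 1) / 2)) (continuousOn_pow hR₁ _) ∘ₗ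
      weakDeriv R₁ R₂ ∘ₗ invPowMulH1 hR₁ ((c₂ / Θ + 1) / 2) ∘ₗ domFst R₁ R₂)
  + mulL2 (fun r => c₂ * n / r) (continuousOn_div hR₁ _) ∘ₗ (H1 R₁ R₂).subtype ∘ₗ domSnd R₁ R₂

/-- The unbounded operator `𝒜ₙ` of `L²(R₁, R₂)²`, with domain `D(𝒜ₙ)`. -/
def opA {R₁ R₂ : ℝ} (hR₁ : 0 < R₁) (c₁ c₂ Θ : ℝ) (n : ℤ) :
    L2Pair R₁ R₂ →ₗ.[ℂ] L2Pair R₁ R₂ where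
  domain := domainA R₁ R₂
  toFun := (WithLp.linearEquiv 2 ℂ (L2 R₁ R₂ × L2 R₁ R₂)).symm.toLinearMap ∘ₗ
    (opAFst hR₁ c₁ c₂ Θ n).prod (opASnd hR₁ c₁ c₂ Θ n)

/-- The resolvent set of an unbounded operator `A`: the complex numbers `z` such that
`z - A : D(A) → E` is a bijection with a bounded inverse. -/
def resolventSet {E : Type*} [NormedAddCommGroup E] [NormedSpace ℂ E] (A : E →ₗ.[ℂ] E) : Set ℂ :=
  {z | ∃ R : E →L[ℂ] E,
    (∀ y : E, ∃ x : A.domain, (x : E) = R y ∧ z • (x : E) - A x = y) ∧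
    (∀ x : A.domain, R (z • (x : E) - A x) = x)}

/-- The spectrum of an unbounded operator. -/
def unboundedSpectrum {E : Type*} [NormedAddCommGroup E] [NormedSpace ℂ E] (A : E →ₗ.[ℂ] E) :
    Set ℂ :=
  (resolventSet A)ᶜ

/-- `f ∈ L²(a, b)` is real-valued. -/
def IsRealValued {a b : ℝ} (f : L2 a b) : Prop :=
  ∀ᵐ r ∂(volume.restrict (Ioo a b)), (f r).im = 0

end

end SOH

/-!
Write `a = R₁`, `b = R₂`, `s = (α + 1) / 2`, `κ = √(c₁ Θ)`, and let `Q` be the orthogonal projection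
of `L²(a, b)` onto the span of `r^s`, the kernel of `u ↦ r^s ∂/∂r (r^(-s) u)`. The operator

  `(u, v) ↦ (Q u - κ r^(-s) ∂/∂r (r^s v), κ r^s ∂/∂r (r^(-s) u))`

with domain `D(𝒜ₙ)` differs from `𝒜ₙ` by a bounded symmetric real operator `C` (`pertCLM`), and it
has an explicit inverse `G` (`modelInv`), built from `Q`, multiplications by `r^s` and `r^(-s)`, and
the Volterra operator `f ↦ ∫ₐʳ f`. This `G` is real; it is compact because the Volterra operator is
(`isCompactOperator_volterra`), and symmetric because the adjoint of the Volterra operator is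
`f ↦ ∫ᵣᵇ f` (`inner_volterra`). That `G` is an inverse (`isCompactInverse_opA`) rests on the
identification of `H¹` with the functions `c + ∫ₐʳ g`, `g ∈ L²` (`exists_eq_add_volterra`, from the
lemma of du Bois-Reymond).

The rest is the spectral theory of an operator `A` with `A G = 1 + C G`
(`IsCompactInverse.exists_eigenbasis`). As `(A - z) G = 1 + (C - z) G`, Fredholm's alternative shows
that each `z` is an eigenvalue or in the resolvent set. A normalised eigenvector `x` of eigenvalue
`ν` is `G ((ν - C) x)`, so orthonormal eigenvectors with bounded eigenvalues lie in a compact set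
and are finite in number. Hence some real `t` is not an eigenvalue, and the spectral theorem for the
compact symmetric real operator `(A - t)⁻¹` gives a complete orthonormal system of real eigenvectors
of `A`, whose eigenvalues tend to infinity in absolute value and exhaust the spectrum.
-/

namespace SOH

/-! ### Operators with compact inverse -/

section Abstract

open scoped InnerProductSpace ComplexConjugate

variable {H : Type*} [NormedAddCommGroup H] [InnerProductSpace ℂ H]

/-- Members of an orthonormal family are at distance `√2`, so a compact set contains only finitely
many of them. -/
lemma finite_of_orthonormal_of_isCompact {ι : Type*} {v : ι → H} (hv : Orthonormal ℂ v)
    {K : Set H} (hK : IsCompact K) (h : ∀ i, v i ∈ K) : Finite ι := by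
  by_contra hinf
  rw [not_finite_iff_infinite] at hinf
  let f := Infinite.natEmbedding ι
  obtain ⟨y, -, ψ, hψ, hlim⟩ := hK.tendsto_subseq (fun n => h (f n))
  have hc := hlim.cauchySeq
  rw [Metric.cauchySeq_iff'] at hc
  obtain ⟨N, hN⟩ := hc 1 one_pos
  have h1 := hN (N + 1) (Nat.le_succ N)
  have hne : f (ψ (N + 1)) ≠ f (ψ N) := by
    simp [f.injective.eq_iff, hψ.injective.eq_iff]
  have h2 : ‖v (f (ψ (N + 1))) - v (f (ψ N))‖ ^ 2 = 2 := by
    rw [@norm_sub_sq ℂ, hv.2 hne, hv.1, hv.1]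
    norm_num
  rw [dist_eq_norm] at h1
  simp only [Function.comp_apply] at h1
  nlinarith [norm_nonneg (v (f (ψ (N + 1))) - v (f (ψ N)))]

/-- A compact symmetric injective operator that commutes with a conjugation `J` has a complete
orthonormal system of eigenvectors that are fixed by `J`. The orthogonal complement of a maximal
orthonormal set of such eigenvectors is invariant under the operator and `J`; were it non-zero, it
would contain an eigenvector, whose real or imaginary part would enlarge the set. -/
lemma exists_real_eigenvectors [CompleteSpace H] (T : H →L[ℂ] H) (hTc : IsCompactOperator T)
    (hTs : (T : H →ₗ[ℂ] H).IsSymmetric) (hT0 : ∀ x, T x = 0 → x = 0)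
    (J : H →ₗ⋆[ℂ] H) (hJJ : ∀ x, J (J x) = x) (hJi : ∀ x y, ⟪J x, J y⟫_ℂ = conj ⟪x, y⟫_ℂ)
    (hJT : ∀ x, T (J x) = J (T x)) :
    ∃ S : Set H, Orthonormal ℂ (Subtype.val : S → H) ∧
      (∀ x ∈ S, J x = x ∧ ∃ μ : ℝ, μ ≠ 0 ∧ T x = (μ : ℂ) • x) ∧
      (Submodule.span ℂ S)ᗮ = ⊥ := by
  obtain ⟨S, hS⟩ := zorn_subset
    {S : Set H | Orthonormal ℂ (Subtype.val : S → H) ∧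
      ∀ x ∈ S, J x = x ∧ ∃ μ : ℝ, μ ≠ 0 ∧ T x = (μ : ℂ) • x} (by
    intro c hc hchain
    refine ⟨⋃₀ c, ⟨?_, ?_⟩, fun s hs => subset_sUnion_of_mem hs⟩
    · exact orthonormal_sUnion_of_directed hchain.directedOn fun s hs => (hc hs).1
    · rintro x ⟨s, hs, hx⟩
      exact (hc hs).2 x hx)
  obtain ⟨hSo, hSe⟩ := hS.prop
  refine ⟨S, hSo, hSe, ?_⟩
  set K := (Submodule.span ℂ S)ᗮ with hKdef
  have memK : ∀ x, x ∈ K ↔ ∀ s ∈ S, ⟪s, x⟫_ℂ = 0 := by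
    intro x
    rw [hKdef, Submodule.mem_orthogonal]
    refine ⟨fun h s hs => h s (Submodule.subset_span hs), fun h u hu => ?_⟩
    induction hu using Submodule.span_induction with
    | mem s hs => exact h s hs
    | zero => simp
    | add a b _ _ ha hb => rw [inner_add_left, ha, hb, add_zero]
    | smul c a _ ha => rw [inner_smul_left, ha, mul_zero]
  have hTK : ∀ x ∈ K, T x ∈ K := by
    intro x hx
    rw [memK] at hx ⊢
    intro s hs
    obtain ⟨-, μ, -, hμ⟩ := hSe s hs
    have := hTs s x
    simp only [ContinuousLinearMap.coe_coe] at this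
    rw [← this, hμ, inner_smul_left, hx s hs, mul_zero]
  have hJK : ∀ x ∈ K, J x ∈ K := by
    intro x hx
    rw [memK] at hx ⊢
    intro s hs
    rw [← (hSe s hs).1, hJi, hx s hs, map_zero]
  -- A non-zero eigenvector in `K` fixed by `J` contradicts the maximality of `S`.
  have key : ∀ (x : H) (μ : ℝ), x ∈ K → μ ≠ 0 → T x = (μ : ℂ) • x → J x = x → x = 0 := by
    intro x μ hx hμ hTx hJx
    by_contra hx0
    have hn : ‖x‖ ≠ 0 := norm_ne_zero_iff.2 hx0
    let y : H := ((‖x‖⁻¹ : ℝ) : ℂ) • x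
    have hyn : ‖y‖ = 1 := by
      simp only [y]
      rw [norm_smul, Complex.norm_real, norm_inv, norm_norm, inv_mul_cancel₀ hn]
    have hyK : y ∈ K := K.smul_mem _ hx
    have hyJ : J y = y := by
      simp only [y]
      rw [LinearMap.map_smulₛₗ, Complex.conj_ofReal, hJx]
    have hyT : T y = (μ : ℂ) • y := by
      simp only [y]
      rw [map_smul, hTx, smul_comm]
    have hins : Orthonormal ℂ (Subtype.val : ↥(insert y S) → H) := by
      classical
      rw [orthonormal_subtype_iff_ite] at hSo ⊢
      have hyS : ∀ s ∈ S, ⟪s, y⟫_ℂ = 0 := (memK y).1 hyK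
      have hyy : ⟪y, y⟫_ℂ = 1 := by
        rw [inner_self_eq_norm_sq_to_K, hyn]; simp
      have hyS' : y ∉ S := fun h => by
        rw [hyS y h] at hyy; exact zero_ne_one hyy
      intro v hv w hw
      rcases hv with rfl | hv <;> rcases hw with rfl | hw
      · rw [if_pos rfl, hyy]
      · rw [if_neg (by rintro rfl; exact hyS' hw), inner_eq_zero_symm]
        exact hyS w hw
      · rw [if_neg (by rintro rfl; exact hyS' hv)]
        exact hyS v hv
      · exact hSo v hv w hw
    have hmem : insert y S ∈ {S : Set H | Orthonormal ℂ (Subtype.val : S → H) ∧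
        ∀ x ∈ S, J x = x ∧ ∃ μ : ℝ, μ ≠ 0 ∧ T x = (μ : ℂ) • x} := by
      refine ⟨hins, ?_⟩
      rintro z (rfl | hz)
      · exact ⟨hyJ, μ, hμ, hyT⟩
      · exact hSe z hz
    have hyS : y ∈ S := hS.le_of_ge hmem (subset_insert y S) (mem_insert y S)
    have := (memK y).1 hyK y hyS
    rw [inner_self_eq_zero] at this
    rw [this, norm_zero] at hyn
    exact zero_ne_one hyn
  let TK : K →L[ℂ] K := T.restrict hTK
  have hTKc : IsCompactOperator TK := hTc.restrict' hTK
  have hTKs : (TK : K →ₗ[ℂ] K).IsSymmetric := hTs.restrict_invariant hTK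
  have hbot : ∀ μ : ℂ, Module.End.HasEigenvalue (TK : Module.End ℂ K) μ → μ = 0 := by
    intro μ hμ
    by_contra hμ0
    have hreal := hTKs.conj_eigenvalue_eq_self hμ
    obtain ⟨t, rfl⟩ := Complex.conj_eq_iff_real.1 hreal
    have ht : t ≠ 0 := fun h => hμ0 (by simp [h])
    obtain ⟨x, hx⟩ := hμ.exists_hasEigenvector
    have hxT : T (x : H) = (t : ℂ) • (x : H) := congrArg Subtype.val hx.apply_eq_smul
    have hJT' : T (J x) = (t : ℂ) • J x := by
      rw [hJT, hxT, LinearMap.map_smulₛₗ, Complex.conj_ofReal]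
    have h1 := key ((x : H) + J x) t (K.add_mem x.2 (hJK _ x.2)) ht
      (by rw [map_add, hxT, hJT', smul_add]) (by rw [map_add, hJJ, add_comm])
    have h2 := key (Complex.I • ((x : H) - J x)) t (K.smul_mem _ (K.sub_mem x.2 (hJK _ x.2))) ht
      (by rw [map_smul, map_sub, hxT, hJT', ← smul_sub, smul_comm])
      (by rw [LinearMap.map_smulₛₗ, map_sub, hJJ, Complex.conj_I, neg_smul, ← smul_neg, neg_sub])
    have h3 : (x : H) = J x := by
      rw [smul_eq_zero, or_iff_right Complex.I_ne_zero, sub_eq_zero] at h2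
      exact h2
    rw [← h3, ← two_smul ℂ, smul_eq_zero, or_iff_right two_ne_zero] at h1
    exact hx.2 (Subtype.ext h1)
  rw [ContinuousLinearMap.eq_zero_of_forall_hasEigenvalue_eq_zero hTKc hTKs] at hbot
  rw [Submodule.eq_bot_iff]
  intro x hx
  apply hT0
  exact congrArg Subtype.val (DFunLike.congr_fun hbot ⟨x, hx⟩)

/-- The operator `A` is given through a compact symmetric `G` with range `D(A)` and a bounded
symmetric `C` such that `A G = 1 + C G`, that is `G = (A - C)⁻¹`. -/
structure IsCompactInverse (A : H →ₗ.[ℂ] H) (G C : H →L[ℂ] H) : Prop where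
  isCompact : IsCompactOperator G
  symm_inv : (G : H →ₗ[ℂ] H).IsSymmetric
  symm_pert : (C : H →ₗ[ℂ] H).IsSymmetric
  apply_inv : ∀ y, ∃ h : G y ∈ A.domain, A ⟨G y, h⟩ = y + C (G y)
  exists_eq : ∀ x : A.domain, ∃ y, G y = x

namespace IsCompactInverse

variable {A : H →ₗ.[ℂ] H} {G C : H →L[ℂ] H}

lemma symmetric (h : IsCompactInverse A G C) (x y : A.domain) :
    ⟪A x, (y : H)⟫_ℂ = ⟪(x : H), A y⟫_ℂ := by
  obtain ⟨⟨x, hx⟩, y, hy⟩ := x, y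
  obtain ⟨x', rfl⟩ := h.exists_eq ⟨x, hx⟩
  obtain ⟨y', rfl⟩ := h.exists_eq ⟨y, hy⟩
  obtain ⟨_, e1⟩ := h.apply_inv x'
  obtain ⟨_, e2⟩ := h.apply_inv y'
  have s1 := h.symm_inv x' y'
  have s2 := h.symm_pert (G x') (G y')
  simp only [ContinuousLinearMap.coe_coe] at s1 s2
  rw [e1, e2, inner_add_left, inner_add_right, s1, s2]

/-- An orthonormal family of eigenvectors whose eigenvalues are bounded lies in the compact closure
of the image of a ball under `G`. -/
lemma finite_of_bounded (h : IsCompactInverse A G C) {ι : Type*} {v : ι → H}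
    (hv : Orthonormal ℂ v) {ν : ι → ℝ} {B : ℝ} (hB : ∀ i, |ν i| ≤ B)
    (hA : ∀ i, ∃ hi : v i ∈ A.domain, A ⟨v i, hi⟩ = (ν i : ℂ) • v i) : Finite ι := by
  obtain ⟨K, hK, hsub⟩ := IsCompactOperator.image_closedBall_subset_compact
    (f := (G : H →ₗ[ℂ] H)) h.isCompact (B + ‖C‖)
  refine finite_of_orthonormal_of_isCompact hv hK fun i => hsub ?_
  obtain ⟨hd, e⟩ := hA i
  obtain ⟨y, hy⟩ := h.exists_eq ⟨v i, hd⟩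
  change G y = v i at hy
  refine ⟨y, ?_, hy⟩
  obtain ⟨hd', e'⟩ := h.apply_inv y
  have e2 : y = (ν i : ℂ) • v i - C (v i) := by
    rw [eq_sub_iff_add_eq, ← e]
    simp only [hy] at e'
    exact e'.symm
  rw [mem_closedBall_zero_iff, e2]
  calc ‖(ν i : ℂ) • v i - C (v i)‖ ≤ ‖(ν i : ℂ) • v i‖ + ‖C (v i)‖ := norm_sub_le _ _
    _ ≤ B + ‖C‖ := by
      refine add_le_add ?_ ?_
      · rw [norm_smul, hv.1, mul_one, Complex.norm_real]; exact hB i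
      · simpa [hv.1] using C.le_opNorm (v i)

/-- The interval `[0, 1]` is infinite, hence cannot consist of eigenvalues only. -/
lemma exists_not_eigenvalue (h : IsCompactInverse A G C) :
    ∃ t : ℝ, ∀ x : A.domain, A x = (t : ℂ) • (x : H) → (x : H) = 0 := by
  by_contra! hcon
  choose x hx hx0 using hcon
  have hn : ∀ t, ‖(x t : H)‖ ≠ 0 := fun t => norm_ne_zero_iff.2 (hx0 t)
  let e : Icc (0 : ℝ) 1 → A.domain := fun t => ((‖(x t : H)‖⁻¹ : ℝ) : ℂ) • x t
  have he : ∀ t, A (e t) = ((t : ℝ) : ℂ) • (e t : H) := by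
    intro t
    simp only [e]
    rw [LinearPMap.map_smul, hx, Submodule.coe_smul, smul_comm]
  have ho : Orthonormal ℂ (fun t => (e t : H)) := by
    refine ⟨fun t => ?_, fun s t hst => ?_⟩
    · simp only [e]
      rw [Submodule.coe_smul, norm_smul, Complex.norm_real, norm_inv, norm_norm,
        inv_mul_cancel₀ (hn t)]
    · have hs := h.symmetric (e s) (e t)
      rw [he, he, inner_smul_left, inner_smul_right, Complex.conj_ofReal, ← sub_eq_zero,
        ← sub_mul, mul_eq_zero, sub_eq_zero, Complex.ofReal_inj] at hs
      exact hs.resolve_left fun h' => hst (Subtype.ext h')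
  have := h.finite_of_bounded ho (ν := fun t => (t : ℝ)) (B := 1)
    (fun t => by rw [abs_of_nonneg t.2.1]; exact t.2.2) (fun t => ⟨(e t).2, he t⟩)
  exact (Icc_infinite (zero_lt_one (α := ℝ))) this

variable [CompleteSpace H]

/-- Fredholm's alternative: a number that is not an eigenvalue of `A` is in the resolvent set,
with a compact resolvent, because `(A - z) G = 1 + (C - z) G` and `(C - z) G` is compact. -/
lemma exists_resolvent (h : IsCompactInverse A G C) {z : ℂ}
    (hz : ∀ x : A.domain, A x = z • (x : H) → (x : H) = 0) :
    ∃ R : H →L[ℂ] H, IsCompactOperator R ∧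
      (∀ y, ∃ x : A.domain, (x : H) = R y ∧ A x - z • (x : H) = y) ∧
      (∀ x : A.domain, R (A x - z • (x : H)) = x) := by
  let P : H →L[ℂ] H := (C - z • 1) ∘L G
  have hPc : IsCompactOperator P := by
    rw [show (P : H → H) = (C - z • 1 : H →L[ℂ] H) ∘ G from rfl]
    exact h.isCompact.clm_comp (C - z • 1)
  have hPG : ∀ y, ∃ hy : G y ∈ A.domain, A ⟨G y, hy⟩ - z • G y = y + P y := by
    intro y
    obtain ⟨hy, e⟩ := h.apply_inv y
    refine ⟨hy, ?_⟩
    rw [e]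
    simp [P, add_sub_assoc]
  have hnot : ¬ Module.End.HasEigenvalue (P : Module.End ℂ H) (-1) := by
    intro hev
    obtain ⟨y, hy⟩ := hev.exists_hasEigenvector
    have hy1 : P y = -y := by simpa using hy.apply_eq_smul
    obtain ⟨hd, e⟩ := hPG y
    rw [hy1, add_neg_cancel, sub_eq_zero] at e
    have hG : G y = 0 := hz ⟨G y, hd⟩ e
    apply hy.2
    rw [← neg_eq_zero, ← hy1]
    simp [P, hG]
  have hres := (hPc.hasEigenvalue_or_mem_resolventSet (neg_ne_zero.2 one_ne_zero)).resolve_left hnot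
  rw [spectrum.mem_resolventSet_iff, ← IsUnit.neg_iff] at hres
  obtain ⟨U, hU⟩ := hres
  have hUx : ∀ y, (U : H →L[ℂ] H) y = y + P y := by
    intro y; rw [hU]; simp [add_comm]
  have hUi : ∀ y, (U : H →L[ℂ] H) ((↑U⁻¹ : H →L[ℂ] H) y) = y := fun y =>
    DFunLike.congr_fun U.mul_inv y
  have hiU : ∀ y, (↑U⁻¹ : H →L[ℂ] H) ((U : H →L[ℂ] H) y) = y := fun y =>
    DFunLike.congr_fun U.inv_mul y
  refine ⟨G ∘L (↑U⁻¹ : H →L[ℂ] H), h.isCompact.comp_clm _, fun y => ?_, fun x => ?_⟩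
  · obtain ⟨hd, e⟩ := hPG ((↑U⁻¹ : H →L[ℂ] H) y)
    exact ⟨⟨_, hd⟩, rfl, by rw [e, ← hUx, hUi]⟩
  · obtain ⟨x, hx⟩ := x
    obtain ⟨y, rfl⟩ := h.exists_eq ⟨x, hx⟩
    obtain ⟨hd, e⟩ := hPG y
    rw [e, ContinuousLinearMap.comp_apply, ← hUx, hiU]

lemma mem_resolventSet (h : IsCompactInverse A G C) {z : ℂ}
    (hz : ∀ x : A.domain, A x = z • (x : H) → (x : H) = 0) : z ∈ SOH.resolventSet A := by
  obtain ⟨R, -, h1, h2⟩ := h.exists_resolvent hz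
  refine ⟨-R, fun y => ?_, fun x => ?_⟩
  · obtain ⟨x, hx, e⟩ := h1 (-y)
    exact ⟨x, by simp [hx], by rw [← neg_sub, e, neg_neg]⟩
  · rw [← neg_sub, map_neg, neg_apply, neg_neg, h2]

/-- The spectral theorem for a real operator with compact inverse, real meaning that `G` and `C`
commute with the conjugation `J`. The hypothesis `hdom` is what makes the space
infinite-dimensional. -/
theorem exists_eigenbasis (h : IsCompactInverse A G C) (hdom : A.domain ≠ ⊤)
    (J : H →ₗ⋆[ℂ] H) (hJJ : ∀ x, J (J x) = x) (hJi : ∀ x y, ⟪J x, J y⟫_ℂ = conj ⟪x, y⟫_ℂ)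
    (hJG : ∀ x, G (J x) = J (G x)) (hJC : ∀ x, C (J x) = J (C x)) :
    ∃ (ν : ℕ → ℝ) (e : HilbertBasis ℕ ℂ H),
      SOH.unboundedSpectrum A = Set.range (fun m => (ν m : ℂ)) ∧
      (∀ m, ∃ h : e m ∈ A.domain, A ⟨e m, h⟩ = (ν m : ℂ) • e m) ∧
      (∀ m, J (e m) = e m) ∧
      Filter.Tendsto (fun m => |ν m|) Filter.atTop Filter.atTop := by
  -- `T = (A - t)⁻¹`; an eigenvalue `μ` of `T` gives the eigenvalue `t + μ⁻¹` of `A`.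
  obtain ⟨t, ht⟩ := h.exists_not_eigenvalue
  obtain ⟨T, hTc, hT1, hT2⟩ := h.exists_resolvent ht
  have hJA : ∀ x : A.domain, ∃ hx : J x ∈ A.domain, A ⟨J x, hx⟩ = J (A x) := by
    rintro ⟨x, hx⟩
    obtain ⟨y, rfl⟩ := h.exists_eq ⟨x, hx⟩
    obtain ⟨h1, e1⟩ := h.apply_inv y
    obtain ⟨h2, e2⟩ := h.apply_inv (J y)
    refine ⟨by rw [← hJG]; exact h2, ?_⟩
    simp only [hJG] at e2
    rw [e1, e2, map_add, hJC]
  have hTs : (T : H →ₗ[ℂ] H).IsSymmetric := by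
    intro x y
    obtain ⟨a, ha, ea⟩ := hT1 x
    obtain ⟨b, hb, eb⟩ := hT1 y
    simp only [ContinuousLinearMap.coe_coe]
    rw [← ha, ← hb, ← ea, ← eb, inner_sub_left, inner_sub_right, h.symmetric, inner_smul_left,
      inner_smul_right, Complex.conj_ofReal]
  have hT0 : ∀ x, T x = 0 → x = 0 := by
    intro x hx
    obtain ⟨a, ha, ea⟩ := hT1 x
    rw [hx] at ha
    rw [← ea, ha, smul_zero, sub_zero, Submodule.coe_eq_zero.1 ha, LinearPMap.map_zero]
  have hJT : ∀ x, T (J x) = J (T x) := by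
    intro x
    obtain ⟨a, ha, ea⟩ := hT1 x
    obtain ⟨h1, e1⟩ := hJA a
    have : T (A ⟨J a, h1⟩ - (t : ℂ) • J a) = J a := hT2 ⟨J a, h1⟩
    rw [e1] at this
    rw [← ha, ← this, ← ea, map_sub, LinearMap.map_smulₛₗ, Complex.conj_ofReal]
  obtain ⟨S, hSo, hSe, hSbot⟩ := exists_real_eigenvectors T hTc hTs hT0 J hJJ hJi hJT
  have hSA : ∀ x : S, ∃ ν : ℝ, ∃ hx : (x : H) ∈ A.domain, A ⟨x, hx⟩ = (ν : ℂ) • (x : H) := by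
    intro x
    obtain ⟨-, μ, hμ, e⟩ := hSe x x.2
    obtain ⟨a, ha, ea⟩ := hT1 x
    have hμ' : (μ : ℂ) ≠ 0 := Complex.ofReal_ne_zero.2 hμ
    have hxa : (x : H) = (((μ : ℂ)⁻¹ • a : A.domain) : H) := by
      rw [Submodule.coe_smul, ha, e, inv_smul_smul₀ hμ']
    refine ⟨t + μ⁻¹, hxa ▸ ((μ : ℂ)⁻¹ • a : A.domain).2, ?_⟩
    have e3 : (⟨x, hxa ▸ ((μ : ℂ)⁻¹ • a : A.domain).2⟩ : A.domain) = (μ : ℂ)⁻¹ • a :=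
      Subtype.ext hxa
    rw [e3, LinearPMap.map_smul, sub_eq_iff_eq_add.1 ea, ha, e, smul_add, smul_comm (t : ℂ),
      inv_smul_smul₀ hμ']
    push_cast
    rw [add_smul, add_comm]
  choose ν₀ hν₀ using hSA
  have hfin : ∀ B : ℝ, {x : S | |ν₀ x| ≤ B}.Finite := by
    intro B
    exact h.finite_of_bounded (v := fun x : {x : S | |ν₀ x| ≤ B} => ((x : S) : H))
      (ν := fun x => ν₀ x) (hSo.comp _ Subtype.val_injective) (fun x => x.2) (fun x => hν₀ x)
  have hcount : Countable S := by
    rw [← countable_univ_iff]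
    refine (countable_iUnion fun n : ℕ => (hfin n).countable).mono fun x _ => ?_
    exact mem_iUnion.2 (exists_nat_ge |ν₀ x|)
  -- Were `S` finite, its span would be the whole space, yet it lies in the domain.
  have hinf : Infinite S := by
    by_contra hf
    rw [not_infinite_iff_finite] at hf
    apply hdom
    have : FiniteDimensional ℂ (Submodule.span ℂ S) := FiniteDimensional.span_of_finite ℂ hf
    rw [Submodule.orthogonal_eq_bot_iff] at hSbot
    rw [eq_top_iff, ← hSbot, Submodule.span_le]
    exact fun x hx => (hν₀ ⟨x, hx⟩).1
  obtain ⟨_⟩ := nonempty_denumerable S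
  let σ : ℕ ≃ S := (Denumerable.eqv S).symm
  have hbot : (Submodule.span ℂ (range fun m => ((σ m : S) : H)))ᗮ = ⊥ := by
    have : range (fun m => ((σ m : S) : H)) = S := by
      rw [show (fun m => ((σ m : S) : H)) = Subtype.val ∘ σ from rfl, σ.surjective.range_comp,
        Subtype.range_coe]
    rw [this, hSbot]
  let e : HilbertBasis ℕ ℂ H := HilbertBasis.mkOfOrthogonalEqBot (hSo.comp σ σ.injective) hbot
  have hem : ∀ m, e m = σ m := fun m => by simp [e]
  have heA : ∀ m, ∃ h : e m ∈ A.domain, A ⟨e m, h⟩ = (ν₀ (σ m) : ℂ) • e m := by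
    intro m
    obtain ⟨h1, h2⟩ := hν₀ (σ m)
    exact ⟨by rw [hem]; exact h1, by simp only [hem]; exact h2⟩
  refine ⟨fun m => ν₀ (σ m), e, ?_, heA, fun m => ?_, ?_⟩
  · ext z
    constructor
    · intro hz
      by_contra hzr
      refine hz (h.mem_resolventSet fun x hx => ?_)
      rw [← e.repr.map_eq_zero_iff]
      ext m
      rw [e.repr_apply_apply]
      obtain ⟨h1, h2⟩ := heA m
      have hs := h.symmetric ⟨e m, h1⟩ x
      rw [h2, hx, inner_smul_left, inner_smul_right, Complex.conj_ofReal, ← sub_eq_zero,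
        ← sub_mul, mul_eq_zero, sub_eq_zero] at hs
      exact hs.resolve_left fun h' => hzr ⟨m, h'⟩
    · rintro ⟨m, rfl⟩ ⟨R, -, hR⟩
      obtain ⟨h1, h2⟩ := heA m
      have := hR ⟨e m, h1⟩
      rw [h2, sub_self, map_zero] at this
      exact e.orthonormal.ne_zero m this.symm
  · rw [hem]; exact (hSe _ (σ m).2).1
  · rw [← Nat.cofinite_eq_atTop]
    refine Tendsto.comp (g := fun x : S => |ν₀ x|) (f := σ) ?_ σ.injective.tendsto_cofinite
    rw [tendsto_atTop]
    intro B
    rw [eventually_cofinite]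
    exact (hfin B).subset fun x hx => (not_le.1 hx).le

end IsCompactInverse

end Abstract

/-! ### Primitives and the Volterra operator -/

section Primitive

open scoped InnerProductSpace ComplexConjugate

/-- Integration by parts for primitives that need not be differentiable: the two iterated integrals
are the integrals of `f(t) g(r)` over the two halves of the square, and the diagonal is null. -/
lemma integral_primitive_mul_add (μ : Measure ℝ) [IsFiniteMeasure μ] [NullSingletonClass μ]
    {f g : ℝ → ℂ} (hf : Integrable f μ) (hg : Integrable g μ) :
    (∫ r, (∫ t in Iio r, f t ∂μ) * g r ∂μ) + ∫ r, f r * (∫ t in Iio r, g t ∂μ) ∂μ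
      = (∫ r, f r ∂μ) * ∫ r, g r ∂μ := by
  have hF : Integrable (fun p : ℝ × ℝ => f p.1 * g p.2) (μ.prod μ) := hf.mul_prod hg
  have m1 : MeasurableSet {p : ℝ × ℝ | p.1 < p.2} := measurableSet_lt measurable_fst measurable_snd
  have m2 : MeasurableSet {p : ℝ × ℝ | p.2 < p.1} := measurableSet_lt measurable_snd measurable_fst
  have e1 : ∫ r, (∫ t in Iio r, f t ∂μ) * g r ∂μ
      = ∫ p, {p : ℝ × ℝ | p.1 < p.2}.indicator (fun p => f p.1 * g p.2) p ∂μ.prod μ := by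
    rw [integral_prod_symm _ (hF.indicator m1)]
    refine integral_congr_ae (.of_forall fun r => ?_)
    simp only
    rw [← integral_mul_const, ← integral_indicator measurableSet_Iio]
    rfl
  have e2 : ∫ r, f r * (∫ t in Iio r, g t ∂μ) ∂μ
      = ∫ p, {p : ℝ × ℝ | p.2 < p.1}.indicator (fun p => f p.1 * g p.2) p ∂μ.prod μ := by
    rw [integral_prod _ (hF.indicator m2)]
    refine integral_congr_ae (.of_forall fun r => ?_)
    simp only
    rw [← integral_const_mul, ← integral_indicator measurableSet_Iio]
    rfl
  rw [e1, e2, ← integral_add (hF.indicator m1) (hF.indicator m2), ← integral_prod_mul]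
  have hdiag : ∀ᵐ p ∂μ.prod μ, p.1 ≠ p.2 := by
    rw [Measure.ae_prod_iff_ae_ae (p := fun p : ℝ × ℝ => p.1 ≠ p.2)
      (measurableSet_eq_fun measurable_fst measurable_snd).compl]
    refine .of_forall fun r => ?_
    filter_upwards [compl_mem_ae_iff.2 (measure_singleton (μ := μ) r)] with t ht
    exact fun h => ht h.symm
  refine integral_congr_ae ?_
  filter_upwards [hdiag] with p hp
  rcases lt_or_gt_of_ne hp with h | h
  · simp [indicator, h, h.le]
  · simp [indicator, h, h.le]

variable {a b : ℝ}

lemma integrable_L2 (f : L2 a b) : Integrable f (volume.restrict (Ioo a b)) :=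
  (Lp.memLp f).integrable (by norm_num)

lemma norm_setIntegral_le (f : L2 a b) {s : Set ℝ} (hs : MeasurableSet s) :
    ‖∫ t in s, f t ∂(volume.restrict (Ioo a b))‖
      ≤ √((volume.restrict (Ioo a b)).real s) * ‖f‖ := by
  rw [← L2.inner_indicatorConstLp_one (𝕜 := ℂ) hs (measure_ne_top _ _) f]
  refine (norm_inner_le_norm _ _).trans (mul_le_mul_of_nonneg_right ?_ (norm_nonneg _))
  rw [norm_indicatorConstLp (by norm_num) (by norm_num), norm_one, one_mul, Real.sqrt_eq_rpow]
  norm_num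

/-- The value at `r` of the primitive `∫ₐʳ f` of `f ∈ L²(a, b)`, which is constant on either side
of `(a, b)`. -/
noncomputable def primitive (f : L2 a b) (r : ℝ) : ℂ :=
  ∫ t in Iio r, f t ∂(volume.restrict (Ioo a b))

lemma norm_primitive_le (f : L2 a b) (r : ℝ) :
    ‖primitive f r‖ ≤ √((volume.restrict (Ioo a b)).real univ) * ‖f‖ :=
  (norm_setIntegral_le f measurableSet_Iio).trans (mul_le_mul_of_nonneg_right
    (Real.sqrt_le_sqrt (measureReal_mono (subset_univ _))) (norm_nonneg _))

lemma norm_primitive_sub_le (f : L2 a b) {r s : ℝ} (h : s ≤ r) :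
    ‖primitive f r - primitive f s‖ ≤ √(r - s) * ‖f‖ := by
  have hi := integrable_L2 f
  have e : primitive f r - primitive f s
      = ∫ t in Ico s r, f t ∂(volume.restrict (Ioo a b)) := by
    rw [sub_eq_iff_eq_add', primitive, primitive, ← Iio_union_Ico_eq_Iio h,
      setIntegral_union _ measurableSet_Ico hi.integrableOn hi.integrableOn]
    exact disjoint_left.2 fun x hx hx' => not_lt.2 hx'.1 hx
  rw [e]
  refine (norm_setIntegral_le f measurableSet_Ico).trans (mul_le_mul_of_nonneg_right
    (Real.sqrt_le_sqrt ?_) (norm_nonneg _))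
  calc (volume.restrict (Ioo a b)).real (Ico s r)
      ≤ volume.real (Ico s r) := by
        refine ENNReal.toReal_mono ?_ (Measure.restrict_apply_le _ _)
        simp
    _ = r - s := by rw [Real.volume_real_Ico_of_le h]

lemma continuous_primitive (f : L2 a b) : Continuous (primitive f) := by
  rw [Metric.continuous_iff']
  intro r ε hε
  have hlim : Tendsto (fun s => √|s - r| * ‖f‖) (𝓝 r) (𝓝 0) := by
    have : Continuous fun s => √|s - r| * ‖f‖ := by fun_prop
    simpa using this.tendsto r
  filter_upwards [hlim.eventually (gt_mem_nhds hε)] with s hs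
  refine lt_of_le_of_lt ?_ hs
  rw [dist_eq_norm]
  rcases le_total r s with h | h
  · rw [abs_of_nonneg (sub_nonneg.2 h)]
    exact norm_primitive_sub_le f h
  · rw [abs_of_nonpos (sub_nonpos.2 h), neg_sub, norm_sub_rev]
    exact norm_primitive_sub_le f h

lemma primitive_left (f : L2 a b) : primitive f a = 0 := by
  rw [primitive, Measure.restrict_restrict measurableSet_Iio]
  have : Iio a ∩ Ioo a b = ∅ := by
    ext x; simp only [mem_inter_iff, mem_Iio, mem_Ioo, mem_empty_iff_false, iff_false]
    intro h; linarith [h.1, h.2.1]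
  simp [this]

lemma primitive_right (f : L2 a b) : primitive f b = ∫ t in Ioo a b, f t := by
  rw [primitive, Measure.restrict_restrict measurableSet_Iio,
    inter_eq_right.2 (show Ioo a b ⊆ Iio b from fun x hx => hx.2)]

lemma primitive_add (f g : L2 a b) (r : ℝ) :
    primitive (f + g) r = primitive f r + primitive g r := by
  simp only [primitive]
  rw [← integral_add (integrable_L2 f).integrableOn (integrable_L2 g).integrableOn]
  exact integral_congr_ae (ae_restrict_of_ae (Lp.coeFn_add f g))

lemma primitive_smul (c : ℂ) (f : L2 a b) (r : ℝ) :
    primitive (c • f) r = c * primitive f r := by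
  simp only [primitive]
  rw [← integral_const_mul]
  exact integral_congr_ae (ae_restrict_of_ae (Lp.coeFn_smul c f))

lemma memLp_primitive (f : L2 a b) : MemLp (primitive f) 2 (volume.restrict (Ioo a b)) :=
  MemLp.of_bound (continuous_primitive f).aestronglyMeasurable _ (.of_forall (norm_primitive_le f))

/-- The Volterra operator `f ↦ ∫ₐʳ f` of `L²(a, b)`. -/
noncomputable def volterra (a b : ℝ) : L2 a b →L[ℂ] L2 a b :=
  LinearMap.mkContinuousOfExistsBound
    { toFun := fun f => (memLp_primitive f).toLp _
      map_add' := fun f g => by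
        rw [← MemLp.toLp_add]
        exact MemLp.toLp_congr _ _ (.of_forall (primitive_add f g))
      map_smul' := fun c f => by
        rw [RingHom.id_apply, ← MemLp.toLp_const_smul]
        exact MemLp.toLp_congr _ _ (.of_forall (primitive_smul c f)) }
    ⟨_, fun f => by
      refine (Lp.norm_le_of_ae_bound (C := √((volume.restrict (Ioo a b)).real univ) * ‖f‖)
        (by positivity) ?_).trans (mul_assoc _ _ _).ge
      filter_upwards [(memLp_primitive f).coeFn_toLp] with r hr
      exact hr ▸ norm_primitive_le f r⟩

lemma volterra_ae (f : L2 a b) : volterra a b f =ᵐ[volume.restrict (Ioo a b)] primitive f :=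
  (memLp_primitive f).coeFn_toLp

lemma isCompactOperator_smulRight {E F : Type*} [NormedAddCommGroup E] [NormedSpace ℂ E]
    [NormedAddCommGroup F] [NormedSpace ℂ F] (c : E →L[ℂ] ℂ) (e : F) :
    IsCompactOperator (c.smulRight e) :=
  (isCompactOperator_of_locallyCompactSpace_dom c).clm_comp
    (ContinuousLinearMap.toSpanSingleton ℂ e)

/-- The Volterra operator is approximated in norm by the finite-rank operators that replace the
primitive by its values at the left ends of `N` intervals of equal length; the error is controlled
because primitives are Hölder continuous with exponent `1 / 2`. -/
lemma isCompactOperator_volterra (hab : a < b) : IsCompactOperator (volterra a b) := by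
  let x : ℕ → ℕ → ℝ := fun N k => a + k * ((b - a) / N)
  let F : ℕ → L2 a b →L[ℂ] L2 a b := fun N => ∑ k ∈ Finset.range N,
    (innerSL ℂ (indicatorConstLp (μ := volume.restrict (Ioo a b)) 2
      (measurableSet_Iio (a := x N k)) (measure_ne_top _ _) (1 : ℂ))).smulRight
    (indicatorConstLp (μ := volume.restrict (Ioo a b)) 2
      (measurableSet_Ico (a := x N k) (b := x N (k + 1))) (measure_ne_top _ _) (1 : ℂ))
  have hFc : ∀ N, IsCompactOperator (F N) := by
    intro N
    change F N ∈ compactOperator (RingHom.id ℂ) (L2 a b) (L2 a b)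
    refine Submodule.sum_mem _ fun k _ => ?_
    exact isCompactOperator_smulRight _ _
  have hF : ∀ N, 0 < N → ∀ f : L2 a b, ‖volterra a b f - F N f‖
      ≤ (measureUnivNNReal (volume.restrict (Ioo a b)) : ℝ) ^ (ENNReal.toReal 2)⁻¹
        * √((b - a) / N) * ‖f‖ := by
    intro N hN f
    have hδ : 0 < (b - a) / N := div_pos (sub_pos.2 hab) (Nat.cast_pos.2 hN)
    rw [mul_assoc]
    refine Lp.norm_le_of_ae_bound (by positivity) ?_
    have hind : ∀ᵐ r ∂(volume.restrict (Ioo a b)), ∀ k,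
        indicatorConstLp (μ := volume.restrict (Ioo a b)) 2
          (measurableSet_Ico (a := x N k) (b := x N (k + 1))) (measure_ne_top _ _) (1 : ℂ) r
        = (Ico (x N k) (x N (k + 1))).indicator (fun _ => 1) r :=
      ae_all_iff.2 fun k => indicatorConstLp_coeFn
    have hsm : ∀ᵐ r ∂(volume.restrict (Ioo a b)), ∀ k,
        (primitive f (x N k) • indicatorConstLp (μ := volume.restrict (Ioo a b)) 2
          (measurableSet_Ico (a := x N k) (b := x N (k + 1))) (measure_ne_top _ _) (1 : ℂ)) r
        = primitive f (x N k) • indicatorConstLp (μ := volume.restrict (Ioo a b)) 2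
          (measurableSet_Ico (a := x N k) (b := x N (k + 1))) (measure_ne_top _ _) (1 : ℂ) r :=
      ae_all_iff.2 fun k => Lp.coeFn_smul _ _
    have hFf : F N f = ∑ k ∈ Finset.range N, primitive f (x N k) •
        indicatorConstLp (μ := volume.restrict (Ioo a b)) 2
          (measurableSet_Ico (a := x N k) (b := x N (k + 1))) (measure_ne_top _ _) (1 : ℂ) := by
      simp only [F, sum_apply, ContinuousLinearMap.smulRight_apply,
        innerSL_apply_apply, L2.inner_indicatorConstLp_one, primitive]
    rw [hFf]
    filter_upwards [Lp.coeFn_sub (volterra a b f) (∑ k ∈ Finset.range N, primitive f (x N k) •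
        indicatorConstLp (μ := volume.restrict (Ioo a b)) 2
          (measurableSet_Ico (a := x N k) (b := x N (k + 1))) (measure_ne_top _ _) (1 : ℂ)),
      volterra_ae f, Lp.coeFn_fun_finsetSum (Finset.range N) (fun k => primitive f (x N k) •
        indicatorConstLp (μ := volume.restrict (Ioo a b)) 2
          (measurableSet_Ico (a := x N k) (b := x N (k + 1))) (measure_ne_top _ _) (1 : ℂ)),
      hind, hsm, ae_restrict_mem measurableSet_Ioo] with r h1 h2 h3 h4 h5 hr
    rw [h1, Pi.sub_apply, h2, h3]
    simp only [h4, h5]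
    -- `k₀` is the index of the interval that contains `r`.
    set k₀ := ⌊(r - a) / ((b - a) / N)⌋₊ with hk₀
    have hk : ∀ k, r ∈ Ico (x N k) (x N (k + 1)) ↔ k = k₀ := by
      intro k
      rw [eq_comm, hk₀, Nat.floor_eq_iff (div_nonneg (sub_nonneg.2 hr.1.le) hδ.le), le_div_iff₀ hδ,
        div_lt_iff₀ hδ, mem_Ico]
      simp only [x]
      push_cast
      constructor <;> rintro ⟨p, q⟩ <;> constructor <;> linarith
    have hk₀N : k₀ < N := by
      rw [hk₀, Nat.floor_lt (div_nonneg (sub_nonneg.2 hr.1.le) hδ.le), div_lt_iff₀ hδ,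
        mul_div_cancel₀ _ (Nat.cast_pos.2 hN).ne']
      linarith [hr.2]
    have hmem := (hk k₀).2 rfl
    rw [Finset.sum_eq_single_of_mem k₀ (Finset.mem_range.2 hk₀N)
      (fun k _ hne => by rw [indicator_of_notMem (fun h => hne ((hk k).1 h)), smul_zero]),
      indicator_of_mem hmem, smul_eq_mul, mul_one]
    refine (norm_primitive_sub_le f hmem.1).trans (mul_le_mul_of_nonneg_right
      (Real.sqrt_le_sqrt ?_) (norm_nonneg _))
    have := hmem.2
    simp only [x] at this ⊢
    push_cast at this
    linarith
  refine isCompactOperator_of_tendsto (F := F) (l := atTop) ?_ (.of_forall hFc)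
  rw [tendsto_iff_norm_sub_tendsto_zero]
  have hlim : Tendsto (fun N : ℕ =>
      (measureUnivNNReal (volume.restrict (Ioo a b)) : ℝ) ^ (ENNReal.toReal 2)⁻¹
        * √((b - a) / N)) atTop (𝓝 0) := by
    have h := ((Real.continuous_sqrt.tendsto 0).comp
      (tendsto_const_div_atTop_nhds_zero_nat (b - a))).const_mul
      ((measureUnivNNReal (volume.restrict (Ioo a b)) : ℝ) ^ (ENNReal.toReal 2)⁻¹)
    simpa using h
  refine squeeze_zero' (.of_forall fun _ => norm_nonneg _) ?_ hlim
  filter_upwards [eventually_gt_atTop 0] with N hN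
  rw [norm_sub_rev]
  exact ContinuousLinearMap.opNorm_le_bound _ (by positivity) fun f => hF N hN f

end Primitive

/-! ### Weak derivatives -/

section WeakDerivative

open scoped InnerProductSpace ComplexConjugate

variable {a b : ℝ}

/-- The constant function `1` of `L²(a, b)`. -/
noncomputable def oneL2 (a b : ℝ) : L2 a b := Lp.const 2 (volume.restrict (Ioo a b)) (1 : ℂ)

lemma oneL2_ae : oneL2 a b =ᵐ[volume.restrict (Ioo a b)] fun _ => 1 :=
  Lp.coeFn_const 2 (volume.restrict (Ioo a b)) (1 : ℂ)

lemma inner_oneL2 (f : L2 a b) : ⟪oneL2 a b, f⟫_ℂ = ∫ t in Ioo a b, f t := by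
  rw [L2.inner_def]
  refine integral_congr_ae ?_
  filter_upwards [oneL2_ae] with r hr
  simp [hr]

lemma setIntegral_deriv_test {φ : ℝ → ℝ} (hφ : ContDiff ℝ ∞ φ) (hs : tsupport φ ⊆ Ioo a b)
    {r : ℝ} (hr : r ∈ Icc a b) :
    ∫ t in Iio r, ((deriv φ t : ℝ) : ℂ) ∂(volume.restrict (Ioo a b)) = φ r := by
  have ha : φ a = 0 := image_eq_zero_of_notMem_tsupport fun h => (hs h).1.false
  have hI : Iio r ∩ Ioo a b = Ioo a r := by
    ext x
    simp only [mem_inter_iff, mem_Iio, mem_Ioo]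
    exact ⟨fun h => ⟨h.2.1, h.1⟩, fun h => ⟨h.2, h.1, h.2.trans_le hr.2⟩⟩
  rw [Measure.restrict_restrict measurableSet_Iio, hI, ← integral_Ioc_eq_integral_Ioo,
    integral_complex_ofReal, ← intervalIntegral.integral_of_le hr.1,
    intervalIntegral.integral_deriv_eq_sub (fun x _ => hφ.differentiable (by simp) x)
      ((hφ.continuous_deriv (by simp)).intervalIntegrable _ _), ha, sub_zero]

lemma integral_deriv_test {φ : ℝ → ℝ} (hab : a ≤ b) (hφ : ContDiff ℝ ∞ φ)
    (hs : tsupport φ ⊆ Ioo a b) : ∫ t in Ioo a b, ((deriv φ t : ℝ) : ℂ) = 0 := by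
  have h := setIntegral_deriv_test hφ hs (right_mem_Icc.2 hab)
  rw [Measure.restrict_restrict measurableSet_Iio,
    inter_eq_right.2 (show Ioo a b ⊆ Iio b from fun x hx => hx.2)] at h
  rw [h, image_eq_zero_of_notMem_tsupport fun h => (hs h).2.false, Complex.ofReal_zero]

lemma isWeakDeriv_volterra (hab : a ≤ b) (f : L2 a b) : IsWeakDeriv (volterra a b f) f := by
  intro φ hφ hc hs
  have hd : Continuous (deriv φ) := hφ.continuous_deriv (by simp)
  have hdi : Integrable (fun t => ((deriv φ t : ℝ) : ℂ)) (volume.restrict (Ioo a b)) :=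
    ((Complex.continuous_ofReal.comp hd).integrableOn_Icc (a := a) (b := b)).mono_set
      Ioo_subset_Icc_self
  have h := integral_primitive_mul_add (volume.restrict (Ioo a b)) hdi (integrable_L2 f)
  rw [integral_deriv_test hab hφ hs, zero_mul, add_comm, add_eq_zero_iff_eq_neg] at h
  have e1 : ∫ r in Ioo a b, ((deriv φ r : ℝ) : ℂ) * volterra a b f r
      = ∫ r in Ioo a b, ((deriv φ r : ℝ) : ℂ) * primitive f r := by
    refine integral_congr_ae ?_
    filter_upwards [volterra_ae f] with r hr
    rw [hr]
  have e2 : ∫ r in Ioo a b, ((φ r : ℝ) : ℂ) * f r = ∫ r in Ioo a b,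
      (∫ t in Iio r, ((deriv φ t : ℝ) : ℂ) ∂(volume.restrict (Ioo a b))) * f r := by
    refine integral_congr_ae ?_
    filter_upwards [ae_restrict_mem measurableSet_Ioo] with r hr
    rw [setIntegral_deriv_test hφ hs (Ioo_subset_Icc_self hr)]
  rw [e1, e2]
  exact h

lemma isWeakDeriv_oneL2 (hab : a ≤ b) : IsWeakDeriv (oneL2 a b) 0 := by
  intro φ hφ hc hs
  have e1 : ∫ r in Ioo a b, ((deriv φ r : ℝ) : ℂ) * oneL2 a b r
      = ∫ r in Ioo a b, ((deriv φ r : ℝ) : ℂ) := by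
    refine integral_congr_ae ?_
    filter_upwards [oneL2_ae] with r hr
    rw [hr, mul_one]
  have e2 : ∫ r in Ioo a b, ((φ r : ℝ) : ℂ) * (0 : L2 a b) r = 0 := by
    rw [← integral_zero ℝ ℂ (μ := volume.restrict (Ioo a b))]
    refine integral_congr_ae ?_
    filter_upwards [Lp.coeFn_zero ℂ 2 (volume.restrict (Ioo a b))] with r hr
    rw [hr]; simp
  rw [e1, e2, integral_deriv_test hab hφ hs, neg_zero]

/-- A test function of mean zero is the derivative of a test function. -/
lemma exists_test_primitive (hab : a < b) {η : ℝ → ℝ} (hη : ContDiff ℝ ∞ η)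
    (hc : HasCompactSupport η) (hs : tsupport η ⊆ Ioo a b) (h0 : ∫ t in a..b, η t = 0) :
    ∃ Φ : ℝ → ℝ, ContDiff ℝ ∞ Φ ∧ HasCompactSupport Φ ∧ tsupport Φ ⊆ Ioo a b ∧ deriv Φ = η := by
  have hmid : (a + b) / 2 ∈ Ioo a b := ⟨by linarith, by linarith⟩
  -- The midpoint is added only to make the set non-empty.
  have hK : IsCompact (insert ((a + b) / 2) (tsupport η)) := hc.isCompact.insert _
  have hKs : insert ((a + b) / 2) (tsupport η) ⊆ Ioo a b := insert_subset hmid hs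
  obtain ⟨c, hcK, hcl⟩ := hK.exists_isLeast (insert_nonempty _ _)
  obtain ⟨d, hdK, hdl⟩ := hK.exists_isGreatest (insert_nonempty _ _)
  have hlt : ∀ t, t < c → η t = 0 := fun t ht => image_eq_zero_of_notMem_tsupport fun h =>
    not_le.2 ht (hcl (mem_insert_of_mem _ h))
  have hgt : ∀ t, d < t → η t = 0 := fun t ht => image_eq_zero_of_notMem_tsupport fun h =>
    not_le.2 ht (hdl (mem_insert_of_mem _ h))
  have hder : deriv (fun r => ∫ t in a..r, η t) = η :=
    funext fun r => hη.continuous.deriv_integral η a r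
  have hsupp : tsupport (fun r => ∫ t in a..r, η t) ⊆ Icc c d := by
    refine closure_minimal (fun r hr => ?_) isClosed_Icc
    by_contra hr'
    apply hr
    rw [mem_Icc, not_and_or, not_le, not_le] at hr'
    rcases hr' with h | h
    · exact intervalIntegral.integral_zero_ae (.of_forall fun t ht => hlt t
        (ht.2.trans_lt (max_lt (hKs hcK).1 h)))
    · have e := intervalIntegral.integral_add_adjacent_intervals
        (hη.continuous.intervalIntegrable (μ := volume) a b)
        (hη.continuous.intervalIntegrable (μ := volume) b r)
      rw [h0, zero_add] at e
      change ∫ t in a..r, η t = 0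
      rw [← e]
      exact intervalIntegral.integral_zero_ae (.of_forall fun t ht => hgt t
        ((lt_min (hKs hdK).2 h).trans ht.1))
  refine ⟨fun r => ∫ t in a..r, η t, ?_, ?_, ?_, hder⟩
  · rw [contDiff_infty_iff_deriv, hder]
    exact ⟨fun r => (hη.continuous.integral_hasStrictDerivAt a r).hasDerivAt.differentiableAt, hη⟩
  · exact isCompact_Icc.of_isClosed_subset (isClosed_tsupport _) hsupp
  · exact hsupp.trans fun r hr => ⟨(hKs hcK).1.trans_le hr.1, hr.2.trans_lt (hKs hdK).2⟩

/-- The lemma of du Bois-Reymond. -/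
lemma exists_eq_smul_oneL2 (hab : a < b) {f : L2 a b} (hf : IsWeakDeriv f 0) :
    ∃ c : ℂ, f = c • oneL2 a b := by
  -- A test function `ρ` of non-zero integral, to correct the mean of an arbitrary one.
  obtain ⟨ρ, hρ, hρc, hρs, hρ1⟩ : ∃ ρ : ℝ → ℝ, ContDiff ℝ ∞ ρ ∧ HasCompactSupport ρ ∧
      tsupport ρ ⊆ Ioo a b ∧ ∫ t in a..b, ρ t = 1 := by
    let β : ContDiffBump ((a + b) / 2) :=
      ⟨(b - a) / 8, (b - a) / 4, by linarith, by linarith⟩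
    have hts : tsupport (β.normed volume) ⊆ Ioo a b := by
      rw [β.tsupport_normed_eq, Real.closedBall_eq_Icc]
      intro x hx
      simp only [β, mem_Icc] at hx
      exact ⟨by linarith [hx.1], by linarith [hx.2]⟩
    refine ⟨β.normed volume, β.contDiff_normed, β.hasCompactSupport_normed, hts, ?_⟩
    rw [intervalIntegral.integral_of_le hab.le, setIntegral_eq_integral_of_forall_compl_eq_zero,
      β.integral_normed]
    exact fun x hx => image_eq_zero_of_notMem_tsupport fun h => hx (Ioo_subset_Ioc_self (hts h))
  set c : ℂ := ∫ t in Ioo a b, ((ρ t : ℝ) : ℂ) * f t with hcdef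
  refine ⟨c, ?_⟩
  have hfz : ∀ φ : ℝ → ℝ, ContDiff ℝ ∞ φ → HasCompactSupport φ → tsupport φ ⊆ Ioo a b →
      ∫ r in Ioo a b, ((deriv φ r : ℝ) : ℂ) * f r = 0 := by
    intro φ h1 h2 h3
    rw [hf φ h1 h2 h3, neg_eq_zero, ← integral_zero ℝ ℂ (μ := volume.restrict (Ioo a b))]
    refine integral_congr_ae ?_
    filter_upwards [Lp.coeFn_zero ℂ 2 (volume.restrict (Ioo a b))] with r hr
    rw [hr]; simp
  rw [← sub_eq_zero, Lp.eq_zero_iff_ae_eq_zero]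
  refine (ae_restrict_iff' measurableSet_Ioo).2 ?_
  refine isOpen_Ioo.ae_eq_zero_of_integral_contDiff_smul_eq_zero ?_ ?_
  · have hi : IntegrableOn (fun r => (f - c • oneL2 a b : L2 a b) r) (Ioo a b) :=
      integrable_L2 _
    exact hi.locallyIntegrableOn
  · intro ψ hψ hψc hψs
    set m : ℝ := ∫ t in a..b, ψ t with hm
    have hψi := hψ.continuous.intervalIntegrable (μ := volume) a b
    have hρi := hρ.continuous.intervalIntegrable (μ := volume) a b
    obtain ⟨Φ, h1, h2, h3, h4⟩ := exists_test_primitive (η := fun t => ψ t - m * ρ t) hab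
      (hψ.sub (contDiff_const.mul hρ)) (hψc.sub hρc.mul_left)
      (by
        refine (tsupport_sub _ _).trans (union_subset hψs ?_)
        exact (tsupport_mul_subset_right (f := fun _ => m)).trans hρs)
      (by
        rw [intervalIntegral.integral_sub hψi (hρi.const_mul m),
          intervalIntegral.integral_const_mul, hρ1, mul_one, sub_self])
    have h5 := hfz Φ h1 h2 h3
    rw [h4] at h5
    have i1 := integrable_test (a := a) (b := b) hψ.continuous.continuousOn f
    have i2 := integrable_test (a := a) (b := b) hρ.continuous.continuousOn f
    have i3 : IntegrableOn (fun r => ((ψ r : ℝ) : ℂ)) (Ioo a b) :=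
      ((Complex.continuous_ofReal.comp hψ.continuous).integrableOn_Icc (a := a) (b := b)).mono_set
        Ioo_subset_Icc_self
    have h6 : ∫ r in Ioo a b, ((ψ r : ℝ) : ℂ) * f r = m * c := by
      rw [hcdef, ← integral_const_mul, ← sub_eq_zero, ← integral_sub i1 (i2.const_mul _), ← h5]
      refine integral_congr_ae (.of_forall fun r => ?_)
      push_cast
      ring
    have h7 : ∫ r in Ioo a b, ((ψ r : ℝ) : ℂ) = m := by
      rw [hm, intervalIntegral.integral_of_le hab.le, integral_Ioc_eq_integral_Ioo,
        integral_complex_ofReal]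
    rw [← setIntegral_eq_integral_of_forall_compl_eq_zero (s := Ioo a b)]
    · have : ∫ r in Ioo a b, ψ r • (f - c • oneL2 a b : L2 a b) r
          = ∫ r in Ioo a b, (((ψ r : ℝ) : ℂ) * f r - ((ψ r : ℝ) : ℂ) * c) := by
        refine integral_congr_ae ?_
        filter_upwards [Lp.coeFn_sub f (c • oneL2 a b), Lp.coeFn_smul c (oneL2 a b), oneL2_ae]
          with r e1 e2 e3
        rw [e1, Pi.sub_apply, e2, Pi.smul_apply, e3, Complex.real_smul, smul_eq_mul, mul_one,
          mul_sub]
      rw [this, integral_sub i1 (i3.mul_const c), integral_mul_const, h6, h7, sub_self]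
    · intro x hx
      rw [image_eq_zero_of_notMem_tsupport fun h => hx (hψs h), zero_smul]

lemma exists_eq_add_volterra (hab : a < b) {f g : L2 a b} (h : IsWeakDeriv f g) :
    ∃ c : ℂ, f = c • oneL2 a b + volterra a b g := by
  have h1 := h.add ((isWeakDeriv_volterra hab.le g).smul (-1))
  rw [neg_one_smul, neg_one_smul, add_neg_cancel] at h1
  obtain ⟨c, hc⟩ := exists_eq_smul_oneL2 hab h1
  exact ⟨c, by rw [← hc]; abel⟩

lemma isWeakDeriv_add_volterra (hab : a < b) (c : ℂ) (g : L2 a b) :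
    IsWeakDeriv (c • oneL2 a b + volterra a b g) g := by
  simpa using ((isWeakDeriv_oneL2 hab.le).smul c).add (isWeakDeriv_volterra hab.le g)

lemma vanishesAtEnds_volterra {g : L2 a b} (hg : ⟪oneL2 a b, g⟫_ℂ = 0) :
    VanishesAtEnds (volterra a b g) :=
  ⟨primitive g, (continuous_primitive g).continuousOn, volterra_ae g, primitive_left g, by
    rw [primitive_right, ← inner_oneL2, hg]⟩

/-- The boundary values of `c + ∫ₐʳ g` are `c` and `c + ∫ₐᵇ g`. -/
lemma VanishesAtEnds.eq_zero (hab : a < b) {c : ℂ} {g : L2 a b}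
    (h : VanishesAtEnds (c • oneL2 a b + volterra a b g)) :
    c = 0 ∧ ⟪oneL2 a b, g⟫_ℂ = 0 := by
  obtain ⟨V, hV, hVe, hVa, hVb⟩ := h
  have hcont : ContinuousOn (fun r => c + primitive g r) (Icc a b) :=
    continuousOn_const.add (continuous_primitive g).continuousOn
  have hae : (fun r => c + primitive g r) =ᵐ[volume.restrict (Icc a b)] V := by
    rw [← restrict_Ioo_eq_restrict_Icc]
    filter_upwards [hVe, Lp.coeFn_add (c • oneL2 a b) (volterra a b g),
      Lp.coeFn_smul c (oneL2 a b), oneL2_ae, volterra_ae g] with r h1 h2 h3 h4 h5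
    rw [← h1, h2, Pi.add_apply, h3, Pi.smul_apply, h4, h5, smul_eq_mul, mul_one]
  have heq := Measure.eqOn_Icc_of_ae_eq volume hab.ne hae hcont hV
  have ha := heq (left_mem_Icc.2 hab.le)
  have hb := heq (right_mem_Icc.2 hab.le)
  simp only [primitive_left, add_zero, hVa] at ha
  simp only [ha, zero_add, hVb, primitive_right] at hb
  exact ⟨ha, by rw [inner_oneL2, hb]⟩

/-- The adjoint of `f ↦ ∫ₐʳ f` is `f ↦ ∫ᵣᵇ f`. -/
lemma inner_volterra (f g : L2 a b) :
    ⟪volterra a b f, g⟫_ℂ = -⟪f, volterra a b g⟫_ℂ + ⟪f, oneL2 a b⟫_ℂ * ⟪oneL2 a b, g⟫_ℂ := by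
  have hfc : Integrable (fun r => conj (f r)) (volume.restrict (Ioo a b)) :=
    Complex.conjCLE.toContinuousLinearMap.integrable_comp (integrable_L2 f)
  have h := integral_primitive_mul_add (volume.restrict (Ioo a b)) hfc (integrable_L2 g)
  have e1 : ⟪volterra a b f, g⟫_ℂ = ∫ r in Ioo a b,
      (∫ t in Iio r, conj (f t) ∂(volume.restrict (Ioo a b))) * g r := by
    rw [L2.inner_def]
    refine integral_congr_ae ?_
    filter_upwards [volterra_ae f] with r hr
    rw [hr, primitive, integral_conj, RCLike.inner_apply, mul_comm]
  have e2 : ⟪f, volterra a b g⟫_ℂ = ∫ r in Ioo a b,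
      conj (f r) * (∫ t in Iio r, g t ∂(volume.restrict (Ioo a b))) := by
    rw [L2.inner_def]
    refine integral_congr_ae ?_
    filter_upwards [volterra_ae g] with r hr
    rw [hr, primitive, RCLike.inner_apply, mul_comm]
  have e3 : ⟪f, oneL2 a b⟫_ℂ = ∫ r in Ioo a b, conj (f r) := by
    rw [← inner_conj_symm, inner_oneL2, integral_conj]
  rw [e1, e2, e3, inner_oneL2, ← h]
  ring

end WeakDerivative

/-! ### Multiplication, conjugation and the inverse of the model operator -/

section Multiplication

open scoped InnerProductSpace ComplexConjugate

variable {a b : ℝ}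

/-- `mulL2` as a bounded operator. -/
noncomputable def mulCLM {m : ℝ → ℝ} (hm : ContinuousOn m (Icc a b)) : L2 a b →L[ℂ] L2 a b :=
  LinearMap.mkContinuousOfExistsBound (mulL2 m hm) (by
    obtain ⟨C, hC⟩ := isCompact_Icc.exists_bound_of_continuousOn hm
    refine ⟨C, fun f => Lp.norm_le_mul_norm_of_ae_le_mul ?_⟩
    filter_upwards [ae_restrict_mem measurableSet_Ioo, mulL2_ae m hm f] with r hr h
    rw [h, norm_mul, Complex.norm_real]
    exact mul_le_mul_of_nonneg_right (hC r (Ioo_subset_Icc_self hr)) (norm_nonneg _))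

lemma mulCLM_ae {m : ℝ → ℝ} (hm : ContinuousOn m (Icc a b)) (f : L2 a b) :
    ∀ᵐ r ∂(volume.restrict (Ioo a b)), mulCLM hm f r = ((m r : ℝ) : ℂ) * f r :=
  mulL2_ae m hm f

lemma inner_mulCLM {m : ℝ → ℝ} (hm : ContinuousOn m (Icc a b)) (f g : L2 a b) :
    ⟪mulCLM hm f, g⟫_ℂ = ⟪f, mulCLM hm g⟫_ℂ := by
  rw [L2.inner_def, L2.inner_def]
  refine integral_congr_ae ?_
  filter_upwards [mulCLM_ae hm f, mulCLM_ae hm g] with r h1 h2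
  rw [h1, h2, RCLike.inner_apply, RCLike.inner_apply, map_mul, Complex.conj_ofReal]
  ring

lemma mulCLM_mulCLM_of_mul_eq_one {m m' : ℝ → ℝ} (hm : ContinuousOn m (Icc a b))
    (hm' : ContinuousOn m' (Icc a b)) (h : ∀ r ∈ Icc a b, m r * m' r = 1) (f : L2 a b) :
    mulCLM hm (mulCLM hm' f) = f := by
  refine Lp.ext ?_
  filter_upwards [ae_restrict_mem measurableSet_Ioo, mulCLM_ae hm (mulCLM hm' f),
    mulCLM_ae hm' f] with r hr h1 h2
  rw [h1, h2, ← mul_assoc, ← Complex.ofReal_mul, h r (Ioo_subset_Icc_self hr), Complex.ofReal_one,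
    one_mul]

lemma VanishesAtEnds.mulCLM {m : ℝ → ℝ} (hm : ContinuousOn m (Icc a b)) {v : L2 a b}
    (h : VanishesAtEnds v) : VanishesAtEnds (mulCLM hm v) := by
  obtain ⟨V, hV, hVe, hVa, hVb⟩ := h
  refine ⟨fun r => ((m r : ℝ) : ℂ) * V r,
    (Complex.continuous_ofReal.comp_continuousOn hm).mul hV, ?_, by simp [hVa], by simp [hVb]⟩
  filter_upwards [hVe, mulCLM_ae hm v] with r h1 h2
  rw [h2, h1]

/-- Complex conjugation on `L²(a, b)`. -/
noncomputable def conjL2 (a b : ℝ) : L2 a b →ₗ⋆[ℂ] L2 a b where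
  toFun f := star f
  map_add' f g := by
    refine Lp.ext ?_
    filter_upwards [Lp.coeFn_star (f + g), Lp.coeFn_add f g, Lp.coeFn_add (star f) (star g),
      Lp.coeFn_star f, Lp.coeFn_star g] with r h1 h2 h3 h4 h5
    rw [h1, h3, Pi.star_apply, h2, Pi.add_apply, Pi.add_apply, h4, h5, star_add]
    rfl
  map_smul' c f := by
    refine Lp.ext ?_
    filter_upwards [Lp.coeFn_star (c • f), Lp.coeFn_smul c f, Lp.coeFn_smul (conj c) (star f),
      Lp.coeFn_star f] with r h1 h2 h3 h4
    rw [h1, h3, Pi.star_apply, h2, Pi.smul_apply, Pi.smul_apply, h4, star_smul]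
    rfl

lemma conjL2_ae (f : L2 a b) :
    ∀ᵐ r ∂(volume.restrict (Ioo a b)), conjL2 a b f r = conj (f r) := Lp.coeFn_star f

lemma conjL2_conjL2 (f : L2 a b) : conjL2 a b (conjL2 a b f) = f := star_star f

lemma inner_conjL2 (f g : L2 a b) : ⟪conjL2 a b f, conjL2 a b g⟫_ℂ = conj ⟪f, g⟫_ℂ := by
  rw [L2.inner_def, L2.inner_def, ← integral_conj]
  refine integral_congr_ae ?_
  filter_upwards [conjL2_ae f, conjL2_ae g] with r h1 h2
  rw [h1, h2, RCLike.inner_apply, RCLike.inner_apply, map_mul]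

lemma mulCLM_conjL2 {m : ℝ → ℝ} (hm : ContinuousOn m (Icc a b)) (f : L2 a b) :
    mulCLM hm (conjL2 a b f) = conjL2 a b (mulCLM hm f) := by
  refine Lp.ext ?_
  filter_upwards [mulCLM_ae hm f, mulCLM_ae hm (conjL2 a b f), conjL2_ae f,
    conjL2_ae (mulCLM hm f)] with r h1 h2 h3 h4
  rw [h2, h3, h4, h1, map_mul, Complex.conj_ofReal]

lemma volterra_conjL2 (f : L2 a b) :
    volterra a b (conjL2 a b f) = conjL2 a b (volterra a b f) := by
  refine Lp.ext ?_
  filter_upwards [volterra_ae f, volterra_ae (conjL2 a b f), conjL2_ae (volterra a b f)]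
    with r h1 h2 h3
  rw [h2, h3, h1, primitive, primitive, ← integral_conj]
  exact integral_congr_ae (ae_restrict_of_ae (conjL2_ae f))

lemma conjL2_oneL2 : conjL2 a b (oneL2 a b) = oneL2 a b := by
  refine Lp.ext ?_
  filter_upwards [conjL2_ae (oneL2 a b), oneL2_ae] with r h1 h2
  rw [h1, h2, map_one]

lemma isRealValued_of_conjL2_eq {f : L2 a b} (h : conjL2 a b f = f) : IsRealValued f := by
  have := conjL2_ae f
  rw [h] at this
  filter_upwards [this] with r hr
  exact Complex.conj_eq_iff_im.1 hr.symm

/-- Complex conjugation on `L²(a, b)²`. -/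
noncomputable def conjPair (a b : ℝ) : L2Pair a b →ₗ⋆[ℂ] L2Pair a b where
  toFun x := WithLp.toLp 2 (conjL2 a b x.fst, conjL2 a b x.snd)
  map_add' x y := by
    simp only [WithLp.add_fst, WithLp.add_snd, map_add]
    rfl
  map_smul' c x := by
    simp only [WithLp.smul_fst, WithLp.smul_snd, LinearMap.map_smulₛₗ]
    rfl

end Multiplication

section Inverse

open scoped InnerProductSpace ComplexConjugate

variable {a b : ℝ} (ha : 0 < a) (s : ℝ)

/-- Multiplication by `r^s`. -/
noncomputable def powCLM (b : ℝ) : L2 a b →L[ℂ] L2 a b := mulCLM (continuousOn_pow ha s)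

/-- Multiplication by `r^(-s)`. -/
noncomputable def invPowCLM (b : ℝ) : L2 a b →L[ℂ] L2 a b := mulCLM (continuousOn_inv_pow ha s)

lemma powCLM_invPowCLM (f : L2 a b) : powCLM ha s b (invPowCLM ha s b f) = f :=
  mulCLM_mulCLM_of_mul_eq_one _ _ (fun _ hr => mul_one_div_cancel
    (Real.rpow_pos_of_pos (ha.trans_le hr.1) s).ne') f

lemma invPowCLM_powCLM (f : L2 a b) : invPowCLM ha s b (powCLM ha s b f) = f :=
  mulCLM_mulCLM_of_mul_eq_one _ _ (fun _ hr => one_div_mul_cancel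
    (Real.rpow_pos_of_pos (ha.trans_le hr.1) s).ne') f

/-- The function `r^s` in `L²(a, b)`, which spans the kernel of `u ↦ r^s ∂/∂r (r^(-s) u)`. -/
noncomputable def powL2 (b : ℝ) : L2 a b := powCLM ha s b (oneL2 a b)

/-- The orthogonal projection of `L²(a, b)` onto the span of `r^s`. -/
noncomputable def powProj (b : ℝ) : L2 a b →L[ℂ] L2 a b :=
  (Submodule.span ℂ {powL2 ha s b}).starProjection

lemma powProj_apply (f : L2 a b) :
    powProj ha s b f
      = (⟪powL2 ha s b, f⟫_ℂ / ((‖powL2 ha s b‖ ^ 2 : ℝ) : ℂ)) • powL2 ha s b :=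
  Submodule.starProjection_singleton ℂ f

lemma powProj_powL2 : powProj ha s b (powL2 ha s b) = powL2 ha s b :=
  Submodule.starProjection_eq_self_iff.2 (Submodule.mem_span_singleton_self _)

lemma inner_powProj (f g : L2 a b) : ⟪powProj ha s b f, g⟫_ℂ = ⟪f, powProj ha s b g⟫_ℂ :=
  Submodule.starProjection_isSymmetric _ f g

lemma powProj_powProj (f : L2 a b) : powProj ha s b (powProj ha s b f) = powProj ha s b f := by
  rw [powProj_apply ha s f, map_smul, powProj_powL2]

lemma inner_powL2_sub_powProj (f : L2 a b) : ⟪powL2 ha s b, f - powProj ha s b f⟫_ℂ = 0 := by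
  rw [inner_sub_right, ← inner_powProj, powProj_powL2, sub_self]

lemma inner_oneL2_powCLM (f : L2 a b) :
    ⟪oneL2 a b, powCLM ha s b f⟫_ℂ = ⟪powL2 ha s b, f⟫_ℂ :=
  (inner_mulCLM _ _ _).symm

lemma isCompactOperator_powProj : IsCompactOperator (powProj ha s b) := by
  have : powProj ha s b = (innerSL ℂ (powL2 ha s b)).smulRight
      ((((‖powL2 ha s b‖ ^ 2 : ℝ) : ℂ))⁻¹ • powL2 ha s b) := by
    ext1 f
    rw [powProj_apply, ContinuousLinearMap.smulRight_apply, innerSL_apply_apply, smul_smul,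
      div_eq_mul_inv]
  rw [this]
  exact isCompactOperator_smulRight _ _

/-- With `Q` the projection onto the span of `r^s`, the operator `(1 - Q) r^s ∫ₐʳ r^(-s)`, which
inverts `u ↦ r^s ∂/∂r (r^(-s) u)` on the orthogonal complement of its kernel. -/
noncomputable def invFst (b : ℝ) : L2 a b →L[ℂ] L2 a b :=
  (1 - powProj ha s b) ∘L powCLM ha s b ∘L volterra a b ∘L invPowCLM ha s b

/-- The adjoint `-r^(-s) ∫ₐʳ r^s (1 - Q)` of `invFst`, which inverts `v ↦ -r^(-s) ∂/∂r (r^s v)`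
under the conditions `v(a) = v(b) = 0`. -/
noncomputable def invSnd (b : ℝ) : L2 a b →L[ℂ] L2 a b :=
  -(invPowCLM ha s b ∘L volterra a b ∘L powCLM ha s b ∘L (1 - powProj ha s b))

lemma invFst_apply (g : L2 a b) : invFst ha s b g
    = powCLM ha s b (volterra a b (invPowCLM ha s b g))
      - powProj ha s b (powCLM ha s b (volterra a b (invPowCLM ha s b g))) := rfl

lemma invSnd_apply (f : L2 a b) : invSnd ha s b f
    = -invPowCLM ha s b (volterra a b (powCLM ha s b (f - powProj ha s b f))) := rfl

lemma inner_invFst (f g : L2 a b) : ⟪invFst ha s b g, f⟫_ℂ = ⟪g, invSnd ha s b f⟫_ℂ := by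
  have e1 : ⟪invFst ha s b g, f⟫_ℂ
      = ⟪powCLM ha s b (volterra a b (invPowCLM ha s b g)), f - powProj ha s b f⟫_ℂ := by
    rw [invFst_apply, inner_sub_left, inner_sub_right, inner_powProj]
  rw [e1, powCLM, inner_mulCLM, inner_volterra]
  change -⟪_, _⟫_ℂ + _ * ⟪oneL2 a b, powCLM ha s b _⟫_ℂ = _
  rw [inner_oneL2_powCLM, inner_powL2_sub_powProj, mul_zero, add_zero, invSnd_apply,
    inner_neg_right, invPowCLM, inner_mulCLM]
  rfl

/-- A bounded operator of `L²(a, b)²` from its two components. -/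
noncomputable def pairCLM (S T : L2Pair a b →L[ℂ] L2 a b) : L2Pair a b →L[ℂ] L2Pair a b :=
  ((WithLp.prodContinuousLinearEquiv 2 ℂ (L2 a b) (L2 a b)).symm :
    L2 a b × L2 a b →L[ℂ] L2Pair a b) ∘L S.prod T

lemma isCompactOperator_pairCLM {S T : L2Pair a b →L[ℂ] L2 a b} (hS : IsCompactOperator S)
    (hT : IsCompactOperator T) : IsCompactOperator (pairCLM S T) := by
  let E : L2 a b × L2 a b →L[ℂ] L2Pair a b :=
    (WithLp.prodContinuousLinearEquiv 2 ℂ (L2 a b) (L2 a b)).symm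
  have h := (hS.clm_comp (E ∘L ContinuousLinearMap.inl ℂ _ _)).add
    (hT.clm_comp (E ∘L ContinuousLinearMap.inr ℂ _ _))
  have e : (pairCLM S T : L2Pair a b → L2Pair a b)
      = (E ∘L ContinuousLinearMap.inl ℂ _ _) ∘ S + (E ∘L ContinuousLinearMap.inr ℂ _ _) ∘ T := by
    funext x
    simp only [Pi.add_apply, Function.comp_apply, ContinuousLinearMap.comp_apply, ← map_add]
    simp [pairCLM, E]
  rw [e]
  exact h

variable (κ : ℝ)

/-- The inverse of `(u, v) ↦ (Q u - κ r^(-s) ∂/∂r (r^s v), κ r^s ∂/∂r (r^(-s) u))` under the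
conditions `v(a) = v(b) = 0`. -/
noncomputable def modelInv (b : ℝ) : L2Pair a b →L[ℂ] L2Pair a b :=
  pairCLM
    (powProj ha s b ∘L WithLp.fstL 2 ℂ _ _
      + ((κ⁻¹ : ℝ) : ℂ) • (invFst ha s b ∘L WithLp.sndL 2 ℂ _ _))
    (((κ⁻¹ : ℝ) : ℂ) • (invSnd ha s b ∘L WithLp.fstL 2 ℂ _ _))

lemma modelInv_fst (y : L2Pair a b) : (modelInv ha s κ b y).fst
    = powProj ha s b y.fst + ((κ⁻¹ : ℝ) : ℂ) • invFst ha s b y.snd := rfl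

lemma modelInv_snd (y : L2Pair a b) : (modelInv ha s κ b y).snd
    = ((κ⁻¹ : ℝ) : ℂ) • invSnd ha s b y.fst := rfl

lemma isCompactOperator_modelInv (hab : a < b) : IsCompactOperator (modelInv ha s κ b) := by
  have hW := isCompactOperator_volterra hab
  have h1 : IsCompactOperator (invFst ha s b) := by
    have := (hW.comp_clm (invPowCLM ha s b)).clm_comp ((1 - powProj ha s b) ∘L powCLM ha s b)
    exact this
  have h2 : IsCompactOperator (invSnd ha s b) := by
    have := ((hW.comp_clm (powCLM ha s b ∘L (1 - powProj ha s b))).clm_comp (invPowCLM ha s b)).neg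
    exact this
  refine isCompactOperator_pairCLM ?_ ?_
  · have := ((isCompactOperator_powProj ha s (b := b)).comp_clm
      (WithLp.fstL 2 ℂ (L2 a b) (L2 a b))).add
      ((h1.comp_clm (WithLp.sndL 2 ℂ (L2 a b) (L2 a b))).smul ((κ⁻¹ : ℝ) : ℂ))
    exact this
  · have := (h2.comp_clm (WithLp.fstL 2 ℂ (L2 a b) (L2 a b))).smul ((κ⁻¹ : ℝ) : ℂ)
    exact this

lemma isSymmetric_modelInv :
    (modelInv ha s κ b : L2Pair a b →ₗ[ℂ] L2Pair a b).IsSymmetric := by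
  intro x y
  have h1 := inner_invFst ha s y.fst x.snd
  have h2 : ⟪invSnd ha s b x.fst, y.snd⟫_ℂ = ⟪x.fst, invFst ha s b y.snd⟫_ℂ := by
    rw [← inner_conj_symm, ← inner_invFst, inner_conj_symm]
  have h3 := inner_powProj ha s x.fst y.fst
  change ⟪(modelInv ha s κ b x).fst, y.fst⟫_ℂ + ⟪(modelInv ha s κ b x).snd, y.snd⟫_ℂ
    = ⟪x.fst, (modelInv ha s κ b y).fst⟫_ℂ + ⟪x.snd, (modelInv ha s κ b y).snd⟫_ℂ
  simp only [modelInv_fst, modelInv_snd, inner_add_left, inner_add_right, inner_smul_left,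
    inner_smul_right, Complex.conj_ofReal, h1, h2, h3]
  ring

lemma powProj_conjL2 (f : L2 a b) :
    powProj ha s b (conjL2 a b f) = conjL2 a b (powProj ha s b f) := by
  have hw : conjL2 a b (powL2 ha s b) = powL2 ha s b := by
    rw [powL2, powCLM, ← mulCLM_conjL2, conjL2_oneL2]
  rw [powProj_apply, powProj_apply, LinearMap.map_smulₛₗ, hw, map_div₀, Complex.conj_ofReal,
    ← inner_conjL2, hw]

lemma powCLM_conjL2 (f : L2 a b) :
    powCLM ha s b (conjL2 a b f) = conjL2 a b (powCLM ha s b f) := mulCLM_conjL2 _ f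

lemma invPowCLM_conjL2 (f : L2 a b) :
    invPowCLM ha s b (conjL2 a b f) = conjL2 a b (invPowCLM ha s b f) := mulCLM_conjL2 _ f

lemma modelInv_conjPair (x : L2Pair a b) :
    modelInv ha s κ b (conjPair a b x) = conjPair a b (modelInv ha s κ b x) := by
  have h1 : ∀ f, invFst ha s b (conjL2 a b f) = conjL2 a b (invFst ha s b f) := fun f => by
    simp only [invFst_apply, powProj_conjL2, powCLM_conjL2, invPowCLM_conjL2, volterra_conjL2,
      map_sub]
  have h2 : ∀ f, invSnd ha s b (conjL2 a b f) = conjL2 a b (invSnd ha s b f) := fun f => by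
    simp only [invSnd_apply, powProj_conjL2, powCLM_conjL2, invPowCLM_conjL2, volterra_conjL2,
      ← map_sub, map_neg]
  change WithLp.toLp 2 (powProj ha s b (conjL2 a b x.fst)
      + ((κ⁻¹ : ℝ) : ℂ) • invFst ha s b (conjL2 a b x.snd),
      ((κ⁻¹ : ℝ) : ℂ) • invSnd ha s b (conjL2 a b x.fst))
    = WithLp.toLp 2 (conjL2 a b (powProj ha s b x.fst + ((κ⁻¹ : ℝ) : ℂ) • invFst ha s b x.snd),
      conjL2 a b (((κ⁻¹ : ℝ) : ℂ) • invSnd ha s b x.fst))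
  rw [h1, h2, powProj_conjL2, map_add, LinearMap.map_smulₛₗ, LinearMap.map_smulₛₗ,
    Complex.conj_ofReal]

variable (d₁ d₂ : ℝ)

/-- The bounded operator `(u, v) ↦ ((d₁ / r) u - Q u, (d₂ / r) v)`. -/
noncomputable def pertCLM (b : ℝ) : L2Pair a b →L[ℂ] L2Pair a b :=
  pairCLM ((mulCLM (continuousOn_div ha d₁) - powProj ha s b) ∘L WithLp.fstL 2 ℂ _ _)
    (mulCLM (continuousOn_div ha d₂) ∘L WithLp.sndL 2 ℂ _ _)

lemma pertCLM_fst (x : L2Pair a b) : (pertCLM ha s d₁ d₂ b x).fst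
    = mulCLM (continuousOn_div ha d₁) x.fst - powProj ha s b x.fst := rfl

lemma pertCLM_snd (x : L2Pair a b) : (pertCLM ha s d₁ d₂ b x).snd
    = mulCLM (continuousOn_div ha d₂) x.snd := rfl

lemma isSymmetric_pertCLM :
    (pertCLM ha s d₁ d₂ b : L2Pair a b →ₗ[ℂ] L2Pair a b).IsSymmetric := by
  intro x y
  change ⟪(pertCLM ha s d₁ d₂ b x).fst, y.fst⟫_ℂ + ⟪(pertCLM ha s d₁ d₂ b x).snd, y.snd⟫_ℂ
    = ⟪x.fst, (pertCLM ha s d₁ d₂ b y).fst⟫_ℂ + ⟪x.snd, (pertCLM ha s d₁ d₂ b y).snd⟫_ℂ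
  simp only [pertCLM_fst, pertCLM_snd, inner_sub_left, inner_sub_right, inner_mulCLM,
    inner_powProj]

lemma pertCLM_conjPair (x : L2Pair a b) :
    pertCLM ha s d₁ d₂ b (conjPair a b x) = conjPair a b (pertCLM ha s d₁ d₂ b x) := by
  change WithLp.toLp 2 (mulCLM (continuousOn_div ha d₁) (conjL2 a b x.fst)
      - powProj ha s b (conjL2 a b x.fst), mulCLM (continuousOn_div ha d₂) (conjL2 a b x.snd))
    = WithLp.toLp 2 (conjL2 a b (mulCLM (continuousOn_div ha d₁) x.fst - powProj ha s b x.fst),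
      conjL2 a b (mulCLM (continuousOn_div ha d₂) x.snd))
  rw [mulCLM_conjL2, mulCLM_conjL2, powProj_conjL2, map_sub]

end Inverse

/-! ### The operator `𝒜ₙ` -/

section Operator

open scoped InnerProductSpace ComplexConjugate

variable {R₁ R₂ : ℝ} (hR₁ : 0 < R₁) (c₁ c₂ Θ : ℝ) (n : ℤ)

/-- The value of `𝒜ₙ` in terms of weak derivatives `p` of `r^s v` and `q` of `r^(-s) u`. -/
lemma opA_apply (x : (opA (R₂ := R₂) hR₁ c₁ c₂ Θ n).domain) {p q : L2 R₁ R₂}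
    (hp : IsWeakDeriv (powCLM hR₁ ((c₂ / Θ + 1) / 2) R₂ (x : L2Pair R₁ R₂).snd) p)
    (hq : IsWeakDeriv (invPowCLM hR₁ ((c₂ / Θ + 1) / 2) R₂ (x : L2Pair R₁ R₂).fst) q) :
    opA (R₂ := R₂) hR₁ c₁ c₂ Θ n x = WithLp.toLp 2
      (mulCLM (continuousOn_div hR₁ (c₁ * n)) (x : L2Pair R₁ R₂).fst
        - ((√(c₁ * Θ) : ℝ) : ℂ) • invPowCLM hR₁ ((c₂ / Θ + 1) / 2) R₂ p,
      ((√(c₁ * Θ) : ℝ) : ℂ) • powCLM hR₁ ((c₂ / Θ + 1) / 2) R₂ q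
        + mulCLM (continuousOn_div hR₁ (c₂ * n)) (x : L2Pair R₁ R₂).snd) := by
  have e1 : weakDeriv R₁ R₂ (powMulH1 hR₁ ((c₂ / Θ + 1) / 2) (domSnd R₁ R₂ x)) = p :=
    (weakDeriv_spec _).unique hp
  have e2 : weakDeriv R₁ R₂ (invPowMulH1 hR₁ ((c₂ / Θ + 1) / 2) (domFst R₁ R₂ x)) = q :=
    (weakDeriv_spec _).unique hq
  rw [← e1, ← e2]
  rfl

/-- A solution `(u, v) ∈ D(𝒜ₙ)` of `(Q u - κ r^(-s) (r^s v)', κ r^s (r^(-s) u)') = 0` vanishes: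
`u` is a multiple `c r^s`, so `r^s v` is the primitive of `κ⁻¹ c r^(2s)`, which vanishes at both ends only
if `c = 0`. -/
lemma eq_zero_of_opA_eq_pertCLM (hR : R₁ < R₂) (hκ : √(c₁ * Θ) ≠ 0)
    (x : (opA (R₂ := R₂) hR₁ c₁ c₂ Θ n).domain)
    (h : opA (R₂ := R₂) hR₁ c₁ c₂ Θ n x
      = pertCLM hR₁ ((c₂ / Θ + 1) / 2) (c₁ * n) (c₂ * n) R₂ x) : (x : L2Pair R₁ R₂) = 0 := by
  set s := (c₂ / Θ + 1) / 2 with hs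
  set κ := √(c₁ * Θ) with hκdef
  have hκ' : ((κ : ℝ) : ℂ) ≠ 0 := Complex.ofReal_ne_zero.2 hκ
  obtain ⟨p, hp⟩ := mulL2_mem_H1 hR₁ (continuousOn_pow hR₁ s) (contDiffOn_pow s) x.2.2.1
  obtain ⟨q, hq⟩ := mulL2_mem_H1 hR₁ (continuousOn_inv_pow hR₁ s) (contDiffOn_inv_pow s) x.2.1
  change IsWeakDeriv (powCLM hR₁ s R₂ (x : L2Pair R₁ R₂).snd) p at hp
  change IsWeakDeriv (invPowCLM hR₁ s R₂ (x : L2Pair R₁ R₂).fst) q at hq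
  rw [opA_apply hR₁ c₁ c₂ Θ n x hp hq, ← hs, ← hκdef] at h
  have h1 := congrArg (fun y : L2Pair R₁ R₂ => y.fst) h
  have h2 := congrArg (fun y : L2Pair R₁ R₂ => y.snd) h
  simp only [WithLp.toLp_fst, WithLp.toLp_snd, pertCLM_fst, pertCLM_snd, sub_right_inj,
    add_eq_right, smul_eq_zero, hκ', false_or] at h1 h2
  have hq0 : q = 0 := by rw [← invPowCLM_powCLM hR₁ s q, h2, map_zero]
  obtain ⟨c, hc⟩ := exists_eq_add_volterra hR hq
  rw [hq0, map_zero, add_zero] at hc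
  have hu : (x : L2Pair R₁ R₂).fst = c • powL2 hR₁ s R₂ := by
    rw [← powCLM_invPowCLM hR₁ s (x : L2Pair R₁ R₂).fst, hc, map_smul, powL2]
  rw [hu, map_smul, powProj_powL2] at h1
  have hp1 : p = ((κ : ℝ) : ℂ)⁻¹ • c • powCLM hR₁ s R₂ (powL2 hR₁ s R₂) := by
    rw [← map_smul, ← h1, map_smul, powCLM_invPowCLM, inv_smul_smul₀ hκ']
  obtain ⟨c', hc'⟩ := exists_eq_add_volterra hR hp
  have hend : VanishesAtEnds (powCLM hR₁ s R₂ (x : L2Pair R₁ R₂).snd) := x.2.2.2.mulCLM _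
  rw [hc'] at hend
  obtain ⟨hc0, hin⟩ := hend.eq_zero hR
  have hw : powL2 hR₁ s R₂ ≠ 0 := by
    intro h0
    have h1 : oneL2 R₁ R₂ = 0 := by
      rw [← invPowCLM_powCLM hR₁ s (oneL2 R₁ R₂), ← powL2, h0, map_zero]
    have h2 := (VanishesAtEnds.eq_zero hR (c := 1) (g := 0)
      ⟨fun _ => 0, continuousOn_const, by
        rw [h1, map_zero, smul_zero, add_zero]
        exact Lp.coeFn_zero ℂ 2 (volume.restrict (Ioo R₁ R₂)), rfl, rfl⟩).1
    exact one_ne_zero h2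
  have hcz : c = 0 := by
    rw [hp1, inner_smul_right, inner_smul_right, inner_oneL2_powCLM] at hin
    simpa [hκ, hw] using hin
  have hv : (x : L2Pair R₁ R₂).snd = 0 := by
    rw [← invPowCLM_powCLM hR₁ s (x : L2Pair R₁ R₂).snd, hc', hp1, hcz, hc0]
    simp
  rw [hcz, zero_smul] at hu
  exact (WithLp.equiv 2 _).injective (Prod.ext hu hv)

lemma opA_modelInv (hR : R₁ < R₂) (hκ : √(c₁ * Θ) ≠ 0) (y : L2Pair R₁ R₂) :
    ∃ h : modelInv hR₁ ((c₂ / Θ + 1) / 2) (√(c₁ * Θ)) R₂ y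
        ∈ (opA (R₂ := R₂) hR₁ c₁ c₂ Θ n).domain,
      opA (R₂ := R₂) hR₁ c₁ c₂ Θ n ⟨_, h⟩ = y + pertCLM hR₁ ((c₂ / Θ + 1) / 2) (c₁ * n) (c₂ * n) R₂
        (modelInv hR₁ ((c₂ / Θ + 1) / 2) (√(c₁ * Θ)) R₂ y) := by
  set s := (c₂ / Θ + 1) / 2 with hs
  set κ := √(c₁ * Θ) with hκdef
  have hκ' : ((κ : ℝ) : ℂ) ≠ 0 := Complex.ofReal_ne_zero.2 hκ
  set x := modelInv hR₁ s κ R₂ y with hx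
  let q : L2 R₁ R₂ := ((κ⁻¹ : ℝ) : ℂ) • invPowCLM hR₁ s R₂ y.snd
  let p : L2 R₁ R₂ := -(((κ⁻¹ : ℝ) : ℂ) • powCLM hR₁ s R₂ (y.fst - powProj hR₁ s R₂ y.fst))
  obtain ⟨c, hc⟩ : ∃ c : ℂ, x.fst = powCLM hR₁ s R₂ (c • oneL2 R₁ R₂ + volterra R₁ R₂ q) := by
    refine ⟨⟪powL2 hR₁ s R₂, y.fst⟫_ℂ / ((‖powL2 hR₁ s R₂‖ ^ 2 : ℝ) : ℂ)
      - ((κ⁻¹ : ℝ) : ℂ) * (⟪powL2 hR₁ s R₂,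
        powCLM hR₁ s R₂ (volterra R₁ R₂ (invPowCLM hR₁ s R₂ y.snd))⟫_ℂ
          / ((‖powL2 hR₁ s R₂‖ ^ 2 : ℝ) : ℂ)), ?_⟩
    rw [hx, modelInv_fst, invFst_apply, powProj_apply, powProj_apply, map_add, map_smul, ← powL2]
    simp only [q, map_smul, smul_sub, sub_smul, smul_smul]
    abel
  have hv : x.snd = invPowCLM hR₁ s R₂ (volterra R₁ R₂ p) := by
    rw [hx, modelInv_snd, invSnd_apply]
    simp only [p, map_neg, map_smul, smul_neg]
  have hp : IsWeakDeriv (powCLM hR₁ s R₂ x.snd) p := by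
    rw [hv, powCLM_invPowCLM]
    exact isWeakDeriv_volterra hR.le p
  have hq : IsWeakDeriv (invPowCLM hR₁ s R₂ x.fst) q := by
    rw [hc, invPowCLM_powCLM]
    exact isWeakDeriv_add_volterra hR c q
  have hin : ⟪oneL2 R₁ R₂, p⟫_ℂ = 0 := by
    simp only [p]
    rw [inner_neg_right, inner_smul_right, inner_oneL2_powCLM, inner_powL2_sub_powProj, mul_zero,
      neg_zero]
  have hdom : x ∈ (opA (R₂ := R₂) hR₁ c₁ c₂ Θ n).domain := by
    refine ⟨?_, ?_, ?_⟩
    · rw [hc]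
      exact mulL2_mem_H1 hR₁ (continuousOn_pow hR₁ s) (contDiffOn_pow s)
        ⟨q, isWeakDeriv_add_volterra hR c q⟩
    · rw [hv]
      exact mulL2_mem_H1 hR₁ (continuousOn_inv_pow hR₁ s) (contDiffOn_inv_pow s)
        ⟨p, isWeakDeriv_volterra hR.le p⟩
    · rw [hv]
      exact (vanishesAtEnds_volterra hin).mulCLM _
  have hQ : powProj hR₁ s R₂ x.fst = powProj hR₁ s R₂ y.fst := by
    rw [hx, modelInv_fst, map_add, powProj_powProj, map_smul, invFst_apply, map_sub,
      powProj_powProj, sub_self, smul_zero, add_zero]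
  refine ⟨hdom, ?_⟩
  rw [opA_apply hR₁ c₁ c₂ Θ n ⟨x, hdom⟩ hp hq]
  refine (WithLp.equiv 2 _).injective (Prod.ext ?_ ?_)
  · change mulCLM (continuousOn_div hR₁ _) x.fst - ((κ : ℝ) : ℂ) • invPowCLM hR₁ s R₂ p
      = y.fst + (mulCLM (continuousOn_div hR₁ _) x.fst - powProj hR₁ s R₂ x.fst)
    simp only [p]
    rw [hQ, map_neg, map_smul, invPowCLM_powCLM, smul_neg, Complex.ofReal_inv, smul_inv_smul₀ hκ']
    abel
  · change ((κ : ℝ) : ℂ) • powCLM hR₁ s R₂ q + mulCLM (continuousOn_div hR₁ _) x.snd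
      = y.snd + mulCLM (continuousOn_div hR₁ _) x.snd
    simp only [q]
    rw [map_smul, powCLM_invPowCLM, Complex.ofReal_inv, smul_inv_smul₀ hκ']

lemma isCompactInverse_opA (hR : R₁ < R₂) (hκ : √(c₁ * Θ) ≠ 0) :
    IsCompactInverse (opA (R₂ := R₂) hR₁ c₁ c₂ Θ n)
      (modelInv hR₁ ((c₂ / Θ + 1) / 2) (√(c₁ * Θ)) R₂)
      (pertCLM hR₁ ((c₂ / Θ + 1) / 2) (c₁ * n) (c₂ * n) R₂) where
  isCompact := isCompactOperator_modelInv _ _ _ hR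
  symm_inv := isSymmetric_modelInv _ _ _
  symm_pert := isSymmetric_pertCLM _ _ _ _
  apply_inv := opA_modelInv hR₁ c₁ c₂ Θ n hR hκ
  exists_eq x := by
    refine ⟨opA (R₂ := R₂) hR₁ c₁ c₂ Θ n x
      - pertCLM hR₁ ((c₂ / Θ + 1) / 2) (c₁ * n) (c₂ * n) R₂ x, ?_⟩
    set y := opA (R₂ := R₂) hR₁ c₁ c₂ Θ n x
      - pertCLM hR₁ ((c₂ / Θ + 1) / 2) (c₁ * n) (c₂ * n) R₂ x with hy
    obtain ⟨hd, e⟩ := opA_modelInv hR₁ c₁ c₂ Θ n hR hκ y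
    have hA : opA (R₂ := R₂) hR₁ c₁ c₂ Θ n x
        = y + pertCLM hR₁ ((c₂ / Θ + 1) / 2) (c₁ * n) (c₂ * n) R₂ x := by
      rw [hy, sub_add_cancel]
    have h0 := eq_zero_of_opA_eq_pertCLM hR₁ c₁ c₂ Θ n hR hκ (⟨_, hd⟩ - x) (by
      rw [LinearPMap.map_sub, e, hA, add_sub_add_left_eq_sub, ← map_sub]
      rfl)
    exact sub_eq_zero.1 h0

lemma domain_opA_ne_top (hR : R₁ < R₂) : (opA (R₂ := R₂) hR₁ c₁ c₂ Θ n).domain ≠ ⊤ := by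
  intro h
  have hmem : WithLp.toLp 2 (0, oneL2 R₁ R₂) ∈ (opA (R₂ := R₂) hR₁ c₁ c₂ Θ n).domain := by
    rw [h]; trivial
  have hv : VanishesAtEnds ((1 : ℂ) • oneL2 R₁ R₂ + volterra R₁ R₂ 0) := by
    rw [map_zero, add_zero, one_smul]
    exact hmem.2.2
  exact one_ne_zero (hv.eq_zero hR).1

end Operator

end SOH

theorem theorem1 (R₁ R₂ c₁ c₂ Θ : ℝ) (hR₁ : 0 < R₁) (hR : R₁ < R₂) (hc₁ : 0 < c₁) (hΘ : 0 < Θ)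
    (n : ℤ) :
    ∃ (ν : ℕ → ℝ) (e : HilbertBasis ℕ ℂ (SOH.L2Pair R₁ R₂)),
      SOH.unboundedSpectrum (SOH.opA (R₂ := R₂) hR₁ c₁ c₂ Θ n) = Set.range (fun m => (ν m : ℂ)) ∧
      (∀ m, ∃ h : e m ∈ (SOH.opA (R₂ := R₂) hR₁ c₁ c₂ Θ n).domain,
        SOH.opA (R₂ := R₂) hR₁ c₁ c₂ Θ n ⟨e m, h⟩ = (ν m : ℂ) • e m) ∧
      (∀ m, SOH.IsRealValued (e m).fst ∧ SOH.IsRealValued (e m).snd) ∧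
      Filter.Tendsto (fun m => |ν m|) Filter.atTop Filter.atTop := by
  obtain ⟨ν, e, h1, h2, h3, h4⟩ :=
    (SOH.isCompactInverse_opA hR₁ c₁ c₂ Θ n hR
      (Real.sqrt_pos.2 (mul_pos hc₁ hΘ)).ne').exists_eigenbasis
      (SOH.domain_opA_ne_top hR₁ c₁ c₂ Θ n hR) (SOH.conjPair R₁ R₂)
      (fun x => (WithLp.equiv 2 _).injective
        (Prod.ext (SOH.conjL2_conjL2 x.fst) (SOH.conjL2_conjL2 x.snd)))
      (fun x y => (congrArg₂ (· + ·) (SOH.inner_conjL2 x.fst y.fst)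
        (SOH.inner_conjL2 x.snd y.snd)).trans (map_add (starRingEnd ℂ) _ _).symm)
      (SOH.modelInv_conjPair hR₁ _ _) (SOH.pertCLM_conjPair hR₁ _ _ _)
  exact ⟨ν, e, h1, h2, fun m =>
    ⟨SOH.isRealValued_of_conjL2_eq (congrArg (fun y : SOH.L2Pair R₁ R₂ => y.fst) (h3 m)),
      SOH.isRealValued_of_conjL2_eq (congrArg (fun y : SOH.L2Pair R₁ R₂ => y.snd) (h3 m))⟩, h4⟩
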